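/- Let $G$ be an ample groupoid, that is, a locally compact Hausdorff topological groupoid whose range and source maps $r,s\colon G\to G^{(0)}$ are local homeomorphisms and whose unit space $G^{(0)}$ is totally disconnected. Suppose that $G^{(0)}$ is compact and that for every $x\in G^{(0)}$ the orbit $G(x)=r(s^{-1}(x))$ has at least three points. Let $C_c(G)$ be the $*$-algebra of continuous compactly supported functions $G\to\mathbb{C}$ with convolution $(f\star g)(\gamma)=\sum_{\alpha\beta=\gamma}f(\alpha)g(\beta)$ and involution $f^*(\gamma)=\overline{f(\gamma^{-1})}$, let $\mathrm{C}^*(G)$ be the full groupoid $\mathrm{C}^*$-algebra, i.e. the completion of $C_c(G)$ in the norm $\|f\|=\sup_\rho\|\rho(f)\|$, where $\rho$ ranges over all $*$-representations of $C_c(G)$ on Hilbert spaces, and let $1=1_{G^{(0)}}$ be its unit. Let $[[G]]$ be the topological full group of $G$: the set of compact open subsets $U\subset G$ such that $r|_U$ and $s|_U$ are injective and $r(U)=s(U)=G^{(0)}$. Then $$\overline{\operatorname{span}}\{\,1-1_U\in \mathrm{C}^*(G) : U\in[[G]]\,\}$$ is a hereditary $\mathrm{C}^*$-subalgebra of $\mathrm{C}^*(G)$: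 it is a closed $*$-subalgebra $B$, and if $a\in\mathrm{C}^*(G)$ and $b\in B$ satisfy $0\le a\le b$, then $a\in B$. -/

import Mathlib

set_option linter.unusedSectionVars false

open Topology Set
open scoped CompactlySupported

/-- A groupoid presented by its set of arrows: `rng g` and `src g` are the units `r(g)` and `s(g)`,
and the product `g * h` is meaningful exactly when `src g = rng h` (the value of the total function
`*` on other pairs is irrelevant, nothing below refers to it). -/
class ArrowGroupoid (G : Type*) extends Mul G, Inv G where
  rng : G → G
  src : G → G
  rng_rng (a : G) : rng (rng a) = rng a
  src_rng (a : G) : src (rng a) = rng a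
  rng_src (a : G) : rng (src a) = src a
  src_src (a : G) : src (src a) = src a
  rng_mul {a b : G} (h : src a = rng b) : rng (a * b) = rng a
  src_mul {a b : G} (h : src a = rng b) : src (a * b) = src b
  comp_assoc {a b c : G} (hab : src a = rng b) (hbc : src b = rng c) : a * b * c = a * (b * c)
  rng_mul_self (a : G) : rng a * a = a
  mul_src_self (a : G) : a * src a = a
  rng_inv (a : G) : rng a⁻¹ = src a
  src_inv (a : G) : src a⁻¹ = rng a
  comp_inv (a : G) : a * a⁻¹ = rng a
  inv_comp (a : G) : a⁻¹ * a = src a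

namespace ArrowGroupoid

/-- The unit space `G⁽⁰⁾`. -/
def units (G : Type*) [ArrowGroupoid G] : Set G := range (rng : G → G)

/-- The range map with values in the unit space. -/
def rngUnit {G : Type*} [ArrowGroupoid G] (g : G) : units G := ⟨rng g, g, rfl⟩

/-- The source map with values in the unit space. -/
def srcUnit {G : Type*} [ArrowGroupoid G] (g : G) : units G := ⟨src g, src g, rng_src g⟩

/-- The orbit `G(x) = r(s⁻¹(x))`. -/
def orbit {G : Type*} [ArrowGroupoid G] (x : G) : Set G := rng '' (src ⁻¹' {x})

end ArrowGroupoid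

open ArrowGroupoid

/-- Ample groupoids: locally compact Hausdorff étale topological groupoids (multiplication, on
composable pairs, and inversion are continuous; `r` and `s` are local homeomorphisms) with totally
disconnected unit space (which carries the subspace topology). -/
class AmpleGroupoid (G : Type*) [TopologicalSpace G] [ArrowGroupoid G] : Prop
    extends LocallyCompactSpace G, T2Space G where
  continuousOn_mul : ContinuousOn (fun p : G × G => p.1 * p.2) {p | src p.1 = rng p.2}
  continuous_inv : Continuous (fun g : G => g⁻¹)
  isLocalHomeomorph_rng : IsLocalHomeomorph (rngUnit : G → units G)
  isLocalHomeomorph_src : IsLocalHomeomorph (srcUnit : G → units G)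
  totallyDisconnected_units : TotallyDisconnectedSpace (units G)

namespace ArrowGroupoid

lemma finsum_mem_sum_comm {ι κ : Type*} (s : Set ι) (A : Finset κ) (F : ι → κ → ℂ)
    (h : ∀ b ∈ A, (s ∩ Function.support (fun a => F a b)).Finite) :
    ∑ᶠ a ∈ s, ∑ b ∈ A, F a b = ∑ b ∈ A, ∑ᶠ a ∈ s, F a b := by
  simp only [finsum_mem_def]
  rw [← finsum_sum_comm]
  · refine finsum_congr fun a => ?_
    by_cases ha : a ∈ s <;> simp [ha]
  · intro b hb
    have := h b hb
    rwa [← Set.support_indicator] at this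

section Algebra

variable {G : Type*} [ArrowGroupoid G]

lemma mem_units_iff {a : G} : a ∈ units G ↔ rng a = a :=
  ⟨by rintro ⟨b, rfl⟩; exact rng_rng b, fun h => ⟨a, h⟩⟩

lemma src_of_mem_units {a : G} (h : a ∈ units G) : src a = a := by
  obtain ⟨b, rfl⟩ := h; exact src_rng b

lemma inv_comp_cancel_left {a b : G} (h : src a = rng b) : a⁻¹ * (a * b) = b := by
  rw [← comp_assoc (src_inv a) h, inv_comp, h, rng_mul_self]

lemma comp_inv_cancel_left {a b : G} (h : rng a = rng b) : a * (a⁻¹ * b) = b := by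
  rw [← comp_assoc (rng_inv a).symm ((src_inv a).trans h), comp_inv, h, rng_mul_self]

lemma inv_inv_eq (a : G) : a⁻¹⁻¹ = a := by
  have h : a * (a⁻¹ * a⁻¹⁻¹) = a⁻¹⁻¹ := comp_inv_cancel_left (by rw [rng_inv, src_inv])
  rw [← h, comp_inv, rng_inv, mul_src_self]

lemma comp_inv_rev {a b : G} (h : src a = rng b) : (a * b)⁻¹ = b⁻¹ * a⁻¹ := by
  have h1 : src b⁻¹ = rng a⁻¹ := by rw [src_inv, rng_inv, h]
  have h2 : a * b * (b⁻¹ * a⁻¹) = rng a := by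
    rw [comp_assoc h (by rw [rng_mul h1, rng_inv]), comp_inv_cancel_left (by rw [rng_inv, h]), comp_inv]
  have h3 : (a * b)⁻¹ * (a * b * (b⁻¹ * a⁻¹)) = b⁻¹ * a⁻¹ :=
    inv_comp_cancel_left (by rw [src_mul h, rng_mul h1, rng_inv])
  rw [← h3, h2, ← rng_mul h, ← src_inv (a * b), mul_src_self]

lemma inv_of_mem_units {a : G} (h : a ∈ units G) : a⁻¹ = a := by
  have := comp_inv a
  have h1 : rng a⁻¹ = a := by rw [rng_inv, src_of_mem_units h]
  rw [mem_units_iff.1 h] at this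
  nth_rewrite 1 [← h1] at this
  rwa [rng_mul_self] at this

/-- The convolution product `(f ⋆ g)(γ) = ∑_{αβ = γ} f(α) g(β)`. -/
noncomputable def conv (f g : G → ℂ) (γ : G) : ℂ :=
  ∑ᶠ p ∈ {p : G × G | src p.1 = rng p.2 ∧ p.1 * p.2 = γ}, f p.1 * g p.2

lemma conv_eq (f g : G → ℂ) (γ : G) :
    conv f g γ = ∑ᶠ α ∈ {α : G | rng α = rng γ}, f α * g (α⁻¹ * γ) := by
  symm
  refine finsum_mem_eq_of_bijOn (fun α => (α, α⁻¹ * γ)) ⟨?_, ?_, ?_⟩ (fun _ _ => rfl)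
  · intro α (hα : rng α = rng γ)
    exact ⟨by rw [rng_mul ((src_inv α).trans hα), rng_inv], comp_inv_cancel_left hα⟩
  · intro α _ β _ h
    exact (Prod.ext_iff.1 h).1
  · rintro ⟨α, β⟩ ⟨h, rfl⟩
    exact ⟨α, (rng_mul h).symm, Prod.ext rfl (inv_comp_cancel_left h)⟩

/-- A bisection: a set on which `r` and `s` are injective. -/
def IsBisection (U : Set G) : Prop := InjOn rng U ∧ InjOn src U

/-- If `f` lives on a set where `r` is injective, at most one term of the convolution survives. -/
lemma conv_of_injOn {f g : G → ℂ} {U : Set G} (hU : InjOn rng U) (hf : Function.support f ⊆ U)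
    {α γ : G} (hα : α ∈ U) (h : rng α = rng γ) : conv f g γ = f α * g (α⁻¹ * γ) := by
  rw [conv_eq, finsum_mem_inter_support_eq (t := {α}), finsum_mem_singleton]
  ext β
  simp only [mem_inter_iff, mem_ofPred_eq, Function.mem_support, mem_singleton_iff]
  constructor
  · rintro ⟨h1, h2⟩
    exact ⟨hU (hf (left_ne_zero_of_mul h2)) hα (h1.trans h.symm), h2⟩
  · rintro ⟨rfl, h2⟩
    exact ⟨h, h2⟩

lemma conv_of_notMem {f g : G → ℂ} {U : Set G} (hf : Function.support f ⊆ U)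
    {γ : G} (h : rng γ ∉ rng '' U) : conv f g γ = 0 := by
  rw [conv_eq]
  refine finsum_mem_of_eqOn_zero fun α hα => ?_
  have : f α = 0 := by
    by_contra h0
    exact h ⟨α, hf h0, hα⟩
  simp [this]

end Algebra

section Topology

variable {G : Type*} [TopologicalSpace G] [ArrowGroupoid G] [AmpleGroupoid G]

lemma continuous_rng : Continuous (rng : G → G) :=
  continuous_subtype_val.comp AmpleGroupoid.isLocalHomeomorph_rng.continuous

lemma continuous_src : Continuous (src : G → G) :=
  continuous_subtype_val.comp AmpleGroupoid.isLocalHomeomorph_src.continuous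

lemma isOpen_units : IsOpen (units G) := by
  rw [isOpen_iff_mem_nhds]
  intro x hx
  obtain ⟨e, hxe, he⟩ := AmpleGroupoid.isLocalHomeomorph_rng x
  have hrx : rng x ∈ e.source := by rwa [mem_units_iff.1 hx]
  filter_upwards [e.open_source.mem_nhds hxe,
    continuous_rng.continuousAt.preimage_mem_nhds (e.open_source.mem_nhds hrx)] with y hy hy'
  rw [mem_units_iff]
  refine e.injOn hy' hy ?_
  rw [← he]
  exact Subtype.ext (rng_rng y)

lemma isClosed_units : IsClosed (units G) := by
  have : units G = {x | rng x = x} := Set.ext fun x => mem_units_iff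
  rw [this]
  exact isClosed_eq continuous_rng continuous_id

/-- The inversion homeomorphism. -/
def invHomeo (G : Type*) [TopologicalSpace G] [ArrowGroupoid G] [AmpleGroupoid G] : G ≃ₜ G where
  toFun g := g⁻¹
  invFun g := g⁻¹
  left_inv := inv_inv_eq
  right_inv := inv_inv_eq
  continuous_toFun := AmpleGroupoid.continuous_inv
  continuous_invFun := AmpleGroupoid.continuous_inv

variable [CompactSpace (units G)]

lemma isCompact_units : IsCompact (units G) := isCompact_iff_compactSpace.2 inferInstance

lemma exists_compactOpen_bisection (g : G) :
    ∃ U : Set G, IsOpen U ∧ IsCompact U ∧ IsBisection U ∧ g ∈ U := by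
  have := AmpleGroupoid.totallyDisconnected_units (G := G)
  obtain ⟨e, hge, he⟩ := AmpleGroupoid.isLocalHomeomorph_rng g
  obtain ⟨e', hge', he'⟩ := AmpleGroupoid.isLocalHomeomorph_src g
  have hopen : IsOpen (e '' (e.source ∩ e'.source)) :=
    e.isOpen_image_of_subset_source (e.open_source.inter e'.open_source) inter_subset_left
  obtain ⟨C, hC, hgC, hCs⟩ := compact_exists_isClopen_in_isOpen hopen
    (mem_image_of_mem e ⟨hge, hge'⟩)
  have hCt : C ⊆ e.target := fun c hc => by
    obtain ⟨a, ha, rfl⟩ := hCs hc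
    exact e.map_source ha.1
  have hsub : e.symm '' C ⊆ e.source ∩ e'.source := by
    rintro _ ⟨c, hc, rfl⟩
    obtain ⟨a, ha, rfl⟩ := hCs hc
    rwa [e.left_inv ha.1]
  refine ⟨e.symm '' C, ?_, hC.1.isCompact.image_of_continuousOn (e.continuousOn_symm.mono hCt),
    ⟨fun a ha b hb h => ?_, fun a ha b hb h => ?_⟩, ⟨e g, hgC, e.left_inv hge⟩⟩
  · exact e.symm.isOpen_image_of_subset_source hC.2 hCt
  · refine e.injOn (hsub ha).1 (hsub hb).1 ?_
    rw [← he]; exact Subtype.ext h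
  · refine e'.injOn (hsub ha).2 (hsub hb).2 ?_
    rw [← he']; exact Subtype.ext h

/-- The restriction of a compactly supported function to a clopen set. -/
noncomputable def restr (f : C_c(G, ℂ)) (C : Set G) (hC : IsClopen C) : C_c(G, ℂ) where
  toFun := C.indicator f
  continuous_toFun := (map_continuous f).indicator (by simp [hC.frontier_eq])
  hasCompactSupport' := f.hasCompactSupport.mono (by rw [Set.support_indicator]; exact inter_subset_right)

/-- Every compactly supported function is a finite sum of functions which live on compact open
bisections. -/
lemma cc_induction {P : C_c(G, ℂ) → Prop} (h0 : P 0) (hadd : ∀ f g, P f → P g → P (f + g))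
    (hb : ∀ (f : C_c(G, ℂ)) (U : Set G), IsOpen U → IsCompact U → IsBisection U →
      Function.support f ⊆ U → P f) (f : C_c(G, ℂ)) : P f := by
  have key : ∃ C : Set G, IsClopen C ∧ tsupport f ⊆ C ∧
      ∀ h : C_c(G, ℂ), Function.support h ⊆ C → P h := by
    refine IsCompact.induction_on (p := fun s => ∃ C : Set G, IsClopen C ∧ s ⊆ C ∧
      ∀ h : C_c(G, ℂ), Function.support h ⊆ C → P h) f.hasCompactSupport ?_ ?_ ?_ ?_
    · refine ⟨∅, isClopen_empty, subset_rfl, fun h hh => ?_⟩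
      have : h = 0 := by
        ext x
        by_contra hx
        exact hh hx
      rwa [this]
    · rintro s t hst ⟨C, hC, htC, h⟩
      exact ⟨C, hC, hst.trans htC, h⟩
    · rintro s t ⟨C, hC, hsC, h⟩ ⟨D, hD, htD, h'⟩
      refine ⟨C ∪ D, hC.union hD, union_subset_union hsC htD, fun k hk => ?_⟩
      have : k = restr k C hC + restr k Cᶜ hC.compl := by
        ext x
        exact (congrFun (Set.indicator_self_add_compl C k) x).symm
      rw [this]
      refine hadd _ _ (h _ ?_) (h' _ ?_)
      · exact Set.support_indicator_subset
      · intro x hx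
        have hx' : x ∈ Cᶜ ∩ Function.support k := by
          rw [← Set.support_indicator]; exact hx
        exact (hk hx'.2).resolve_left hx'.1
    · intro x _
      obtain ⟨U, hU, hUc, hUb, hx⟩ := exists_compactOpen_bisection x
      exact ⟨U, mem_nhdsWithin_of_mem_nhds (hU.mem_nhds hx), U, ⟨hUc.isClosed, hU⟩, subset_rfl,
        fun h hh => hb h U hU hUc hUb hh⟩
  obtain ⟨C, -, hfC, h⟩ := key
  exact h f ((subset_tsupport f).trans hfC)

lemma finite_fibre (f : C_c(G, ℂ)) (x : G) :
    ({α | rng α = x} ∩ Function.support f).Finite := by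
  induction f using cc_induction with
  | h0 => simp
  | hadd f g hf hg =>
    refine (hf.union hg).subset ?_
    rintro α ⟨h1, h2⟩
    rcases Function.support_add f g h2 with h | h
    · exact Or.inl ⟨h1, h⟩
    · exact Or.inr ⟨h1, h⟩
  | hb f U _ _ hU hf =>
    refine Set.Subsingleton.finite ?_
    rintro α ⟨h1, h2⟩ β ⟨h3, h4⟩
    exact hU.1 (hf h2) (hf h4) (h1.trans h3.symm)

lemma finite_conv (f : C_c(G, ℂ)) (h : G → ℂ) (x : G) :
    ({α | rng α = x} ∩ Function.support (fun α => f α * h α)).Finite :=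
  (finite_fibre f x).subset fun _ hα => ⟨hα.1, left_ne_zero_of_mul hα.2⟩

lemma conv_add_left (f₁ f₂ : C_c(G, ℂ)) (g : G → ℂ) (γ : G) :
    conv (f₁ + f₂ : C_c(G, ℂ)) g γ = conv f₁ g γ + conv f₂ g γ := by
  simp only [conv_eq, CompactlySupportedContinuousMap.add_apply, add_mul]
  exact finsum_mem_add_distrib' (finite_conv f₁ (fun α => g (α⁻¹ * γ)) _)
    (finite_conv f₂ (fun α => g (α⁻¹ * γ)) _)

lemma conv_add_right (f : C_c(G, ℂ)) (g₁ g₂ : G → ℂ) (γ : G) :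
    conv f (g₁ + g₂) γ = conv f g₁ γ + conv f g₂ γ := by
  simp only [conv_eq, Pi.add_apply, mul_add]
  exact finsum_mem_add_distrib' (finite_conv f (fun α => g₁ (α⁻¹ * γ)) _)
    (finite_conv f (fun α => g₂ (α⁻¹ * γ)) _)

lemma continuous_conv (f g : C_c(G, ℂ)) : Continuous (conv f g) := by
  induction f using cc_induction with
  | h0 =>
    have : conv (0 : C_c(G, ℂ)) g = fun _ => (0 : ℂ) := by
      ext γ
      exact conv_of_notMem (U := ∅) (by simp) (by simp)
    rw [this]
    exact continuous_const
  | hadd f₁ f₂ h₁ h₂ =>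
    have : conv (f₁ + f₂ : C_c(G, ℂ)) g = fun γ => conv f₁ g γ + conv f₂ g γ := by
      ext γ
      exact conv_add_left f₁ f₂ g γ
    rw [this]
    exact h₁.add h₂
  | hb f U hUo hUc hU hf =>
    rw [continuous_iff_continuousAt]
    intro γ₀
    by_cases hγ : rng γ₀ ∈ rng '' U
    · obtain ⟨α₀, hα₀, hr⟩ := hγ
      obtain ⟨e, hαe, he⟩ := AmpleGroupoid.isLocalHomeomorph_rng α₀
      have hr' : rngUnit γ₀ = e α₀ := by rw [← he]; exact Subtype.ext hr.symm
      have hmem : rngUnit γ₀ ∈ e.target := by rw [hr']; exact e.map_source hαe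
      have hval : e.symm (rngUnit γ₀) = α₀ := by rw [hr', e.left_inv hαe]
      have hrc : ContinuousAt (rngUnit : G → units G) γ₀ :=
        AmpleGroupoid.isLocalHomeomorph_rng.continuous.continuousAt
      have hτ : ContinuousAt (fun γ => e.symm (rngUnit γ)) γ₀ :=
        ContinuousAt.comp (f := rngUnit) (e.continuousAt_symm hmem) hrc
      have hcomp : ∀ᶠ γ in 𝓝 γ₀, rng (e.symm (rngUnit γ)) = rng γ := by
        filter_upwards [hrc.preimage_mem_nhds (e.open_target.mem_nhds hmem)] with γ h
        have := e.right_inv h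
        rw [← he] at this
        exact congrArg Subtype.val this
      have hin : ∀ᶠ γ in 𝓝 γ₀, e.symm (rngUnit γ) ∈ U :=
        hτ.preimage_mem_nhds (hUo.mem_nhds (by rwa [hval]))
      have heq : (fun γ => f (e.symm (rngUnit γ)) * g ((e.symm (rngUnit γ))⁻¹ * γ))
          =ᶠ[𝓝 γ₀] conv f g := by
        filter_upwards [hcomp, hin] with γ h1 h2
        exact (conv_of_injOn hU.1 hf h2 h1).symm
      refine ContinuousAt.congr ?_ heq
      refine ((map_continuous f).continuousAt.comp hτ).mul
        ((map_continuous g).continuousAt.comp ?_)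
      have hS : ((e.symm (rngUnit γ₀))⁻¹, γ₀) ∈ {p : G × G | src p.1 = rng p.2} := by
        rw [mem_ofPred_eq, src_inv, hval, hr]
      have hm := AmpleGroupoid.continuousOn_mul (G := G) _ hS
      refine Filter.Tendsto.comp (f := fun γ => ((e.symm (rngUnit γ))⁻¹, γ)) hm ?_
      refine tendsto_nhdsWithin_iff.2 ⟨?_, ?_⟩
      · exact ((AmpleGroupoid.continuous_inv.continuousAt.comp hτ).prodMk continuousAt_id)
      · filter_upwards [hcomp] with γ h
        exact (src_inv _).trans h
    · have hcl : IsClosed (rng '' U) := (hUc.image continuous_rng).isClosed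
      have heq : (fun _ => (0 : ℂ)) =ᶠ[𝓝 γ₀] conv f g := by
        filter_upwards [continuous_rng.continuousAt.preimage_mem_nhds
          (hcl.isOpen_compl.mem_nhds hγ)] with γ h
        exact (conv_of_notMem hf h).symm
      exact continuousAt_const.congr heq

lemma hasCompactSupport_conv (f g : C_c(G, ℂ)) : HasCompactSupport (conv f g) := by
  have hK : IsCompact ((tsupport f ×ˢ tsupport g) ∩ {p : G × G | src p.1 = rng p.2}) :=
    (f.hasCompactSupport.prod g.hasCompactSupport).inter_right
      (isClosed_eq (continuous_src.comp continuous_fst) (continuous_rng.comp continuous_snd))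
  refine HasCompactSupport.intro
    (hK.image_of_continuousOn (AmpleGroupoid.continuousOn_mul.mono inter_subset_right)) ?_
  intro γ hγ
  refine finsum_mem_of_eqOn_zero ?_
  rintro ⟨α, β⟩ ⟨h1, h2⟩
  by_contra h
  exact hγ ⟨(α, β), ⟨⟨subset_tsupport f (left_ne_zero_of_mul h),
    subset_tsupport g (right_ne_zero_of_mul h)⟩, h1⟩, h2⟩

lemma conv_assoc (f g h : C_c(G, ℂ)) (γ : G) :
    conv (conv f g) h γ = conv f (conv g h) γ := by
  set A := (finite_fibre f (rng γ)).toFinset with hA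
  have hAsub : ∀ (k : G → ℂ) (x : G), rng x = rng γ →
      ∑ᶠ β ∈ {β : G | rng β = rng x}, f β * k β = ∑ β ∈ A, f β * k β := by
    intro k x hx
    refine finsum_mem_eq_sum_of_inter_support_eq _ ?_
    ext β
    simp only [hA, hx, mem_inter_iff, mem_ofPred_eq, Function.mem_support, Finite.coe_toFinset]
    constructor
    · rintro ⟨h1, h2⟩; exact ⟨⟨h1, left_ne_zero_of_mul h2⟩, h2⟩
    · rintro ⟨⟨h1, _⟩, h2⟩; exact ⟨h1, h2⟩
  have hrA : ∀ β ∈ A, rng β = rng γ := by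
    intro β hβ
    rw [hA, Finite.mem_toFinset] at hβ
    exact hβ.1
  have lhs : conv (conv f g) h γ =
      ∑ᶠ α ∈ {α : G | rng α = rng γ}, ∑ β ∈ A, f β * g (β⁻¹ * α) * h (α⁻¹ * γ) := by
    rw [conv_eq]
    refine finsum_mem_congr rfl fun α hα => ?_
    rw [conv_eq, hAsub (fun β => g (β⁻¹ * α)) α hα, Finset.sum_mul]
  have rhs : conv f (conv g h) γ = ∑ β ∈ A, f β * conv g h (β⁻¹ * γ) := by
    rw [conv_eq, hAsub (fun β => conv g h (β⁻¹ * γ)) γ rfl]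
  rw [lhs, rhs]
  have hbij : ∀ β ∈ A, BijOn (fun δ => β * δ) {δ | rng δ = rng (β⁻¹ * γ)}
      {α : G | rng α = rng γ} := by
    intro β hβ
    have h1 : rng (β⁻¹ * γ) = src β := by
      rw [rng_mul ((src_inv β).trans (hrA β hβ)), rng_inv]
    rw [h1]
    refine ⟨fun δ (hδ : rng δ = src β) => ?_, fun δ (hδ : rng δ = src β) ε
      (hε : rng ε = src β) h => ?_, fun α (hα : rng α = rng γ) => ?_⟩
    · exact (rng_mul hδ.symm).trans (hrA β hβ)
    · have := congrArg (fun x => β⁻¹ * x) h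
      simpa only [inv_comp_cancel_left hδ.symm, inv_comp_cancel_left hε.symm] using this
    · have hβα : rng β = rng α := (hrA β hβ).trans hα.symm
      exact ⟨β⁻¹ * α, (rng_mul ((src_inv β).trans hβα)).trans (rng_inv β),
        comp_inv_cancel_left hβα⟩
  rw [show (∑ᶠ α ∈ {α : G | rng α = rng γ}, ∑ β ∈ A, f β * g (β⁻¹ * α) * h (α⁻¹ * γ)) =
    ∑ β ∈ A, ∑ᶠ α ∈ {α : G | rng α = rng γ}, f β * g (β⁻¹ * α) * h (α⁻¹ * γ) from ?_]
  · refine Finset.sum_congr rfl fun β hβ => ?_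
    rw [conv_eq]
    have h1 : rng (β⁻¹ * γ) = src β := by
      rw [rng_mul ((src_inv β).trans (hrA β hβ)), rng_inv]
    rw [mul_finsum_mem]
    symm
    refine finsum_mem_eq_of_bijOn _ (hbij β hβ) fun δ hδ => ?_
    have hδ' : src β = rng δ := (hδ.trans h1).symm
    rw [inv_comp_cancel_left hδ', comp_inv_rev hδ', comp_assoc (by rw [src_inv, rng_inv, hδ'])
      (by rw [src_inv, hrA β hβ])]
    ring
  · refine finsum_mem_sum_comm _ _ _ fun β hβ => ?_
    refine ((finite_fibre g (rng (β⁻¹ * γ))).image (fun δ => β * δ)).subset ?_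
    rintro α ⟨hα, hα'⟩
    obtain ⟨δ, hδ, rfl⟩ := (hbij β hβ).2.2 hα
    refine ⟨δ, ⟨hδ, ?_⟩, rfl⟩
    have hδ' : src β = rng δ := by
      rw [show rng δ = rng (β⁻¹ * γ) from hδ, rng_mul ((src_inv β).trans (hrA β hβ)), rng_inv]
    have h3 := right_ne_zero_of_mul (left_ne_zero_of_mul hα')
    rw [inv_comp_cancel_left hδ'] at h3
    exact h3

end Topology

end ArrowGroupoid

open ArrowGroupoid

universe u

/-- The complex vector space `C_c(G)`, under a name of its own since it is going to carry the
convolution product instead of the pointwise one. -/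
def ConvAlg (G : Type u) [TopologicalSpace G] : Type u := C_c(G, ℂ)

namespace ConvAlg

section Linear

variable {G : Type u} [TopologicalSpace G]

noncomputable instance : AddCommGroup (ConvAlg G) := inferInstanceAs (AddCommGroup C_c(G, ℂ))
noncomputable instance : Module ℂ (ConvAlg G) := inferInstanceAs (Module ℂ C_c(G, ℂ))
instance : FunLike (ConvAlg G) G ℂ := inferInstanceAs (FunLike C_c(G, ℂ) G ℂ)

lemma ext {f g : ConvAlg G} (h : ∀ x, f x = g x) : f = g := DFunLike.ext f g h
lemma zero_apply (x : G) : (0 : ConvAlg G) x = 0 := rfl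
lemma add_apply (f g : ConvAlg G) (x : G) : (f + g) x = f x + g x := rfl
lemma smul_apply (c : ℂ) (f : ConvAlg G) (x : G) : (c • f) x = c * f x := rfl
lemma continuous (f : ConvAlg G) : Continuous f := map_continuous (F := C_c(G, ℂ)) f
lemma hasCompactSupport (f : ConvAlg G) : HasCompactSupport f :=
  CompactlySupportedContinuousMap.hasCompactSupport f

/-- The characteristic function `1_U` of a compact open (hence clopen) set `U`. -/
noncomputable def ind [T2Space G] (U : Set G) (hU : IsOpen U) (hUc : IsCompact U) : ConvAlg G where
  toFun := U.indicator 1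
  continuous_toFun := continuous_one.indicator (by
    simp [(show IsClopen U from ⟨hUc.isClosed, hU⟩).frontier_eq])
  hasCompactSupport' := HasCompactSupport.intro hUc fun _ hx => Set.indicator_of_notMem hx _

end Linear

section Star

variable {G : Type u} [TopologicalSpace G] [ArrowGroupoid G] [AmpleGroupoid G]

/-- The involution `f^*(γ) = conj f(γ⁻¹)`. -/
noncomputable instance : Star (ConvAlg G) where
  star f :=
    { toFun := fun γ => star (f γ⁻¹)
      continuous_toFun := continuous_star.comp (f.continuous.comp AmpleGroupoid.continuous_inv)
      hasCompactSupport' := (f.hasCompactSupport.comp_homeomorph (invHomeo G)).comp_left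
        (g := star) (star_zero ℂ) }

lemma star_apply (f : ConvAlg G) (γ : G) : (star f) γ = star (f γ⁻¹) := rfl

end Star

section Ring

variable {G : Type u} [TopologicalSpace G] [ArrowGroupoid G] [AmpleGroupoid G]
  [CompactSpace (units G)]

noncomputable instance : Mul (ConvAlg G) where
  mul f g :=
    { toFun := conv f g
      continuous_toFun := continuous_conv f g
      hasCompactSupport' := hasCompactSupport_conv f g }

noncomputable instance : One (ConvAlg G) where
  one := ind (units G) isOpen_units isCompact_units

lemma mul_apply (f g : ConvAlg G) (γ : G) : (f * g) γ = conv f g γ := rfl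

lemma one_apply (γ : G) : (1 : ConvAlg G) γ = (units G).indicator 1 γ := rfl

lemma support_one : Function.support (1 : ConvAlg G) ⊆ units G := Set.support_indicator_subset

lemma rng_injOn_units : InjOn rng (units G) := fun a ha b hb h => by
  rwa [mem_units_iff.1 ha, mem_units_iff.1 hb] at h

lemma conv_units_left {f g : G → ℂ} (hf : Function.support f ⊆ units G) (γ : G) :
    conv f g γ = f (rng γ) * g γ := by
  have h1 : (rng γ)⁻¹ = rng γ := inv_of_mem_units ⟨γ, rfl⟩
  rw [conv_of_injOn rng_injOn_units hf ⟨γ, rfl⟩ (rng_rng γ), h1, rng_mul_self]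

lemma star_star' (f : ConvAlg G) : star (star f) = f :=
  ext fun γ => by rw [star_apply, star_apply, star_star, inv_inv_eq]

lemma star_mul' (f g : ConvAlg G) : star (f * g) = star g * star f := by
  refine ext fun γ => ?_
  have h1 : ∀ x : ℂ, star x = (starAddEquiv : ℂ ≃+ ℂ) x := fun _ => rfl
  rw [star_apply, mul_apply, mul_apply, conv, conv, h1, AddEquiv.map_finsum]
  simp only [AddEquiv.map_finsum]
  refine finsum_mem_eq_of_bijOn (fun p : G × G => (p.2⁻¹, p.1⁻¹)) ⟨?_, ?_, ?_⟩ ?_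
  · rintro ⟨α, β⟩ ⟨h, h'⟩
    refine ⟨by rw [src_inv, rng_inv]; exact h.symm, ?_⟩
    change β⁻¹ * α⁻¹ = γ
    rw [← comp_inv_rev h, h', inv_inv_eq]
  · rintro ⟨α, β⟩ _ ⟨α', β'⟩ _ h
    have h2 := (Prod.ext_iff.1 h).1
    have h3 := (Prod.ext_iff.1 h).2
    exact Prod.ext ((invHomeo G).injective h3) ((invHomeo G).injective h2)
  · rintro ⟨α, β⟩ ⟨h, h'⟩
    have h2 : src β⁻¹ = rng α⁻¹ := by rw [src_inv, rng_inv]; exact h.symm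
    refine ⟨(β⁻¹, α⁻¹), ⟨h2, ?_⟩, Prod.ext (inv_inv_eq α) (inv_inv_eq β)⟩
    change β⁻¹ * α⁻¹ = γ⁻¹
    rw [← comp_inv_rev h, h']
  · rintro ⟨α, β⟩ _
    rw [star_apply, star_apply, inv_inv_eq, inv_inv_eq, ← h1, star_mul]

lemma star_one' : star (1 : ConvAlg G) = 1 := by
  refine ext fun γ => ?_
  rw [star_apply, one_apply, one_apply]
  by_cases h : γ ∈ units G
  · rw [inv_of_mem_units h]
    simp [h]
  · have h' : γ⁻¹ ∉ units G := fun h' => h (by rw [← inv_inv_eq γ, inv_of_mem_units h']; exact h')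
    simp [h, h']

lemma one_mul' (f : ConvAlg G) : 1 * f = f := by
  refine ext fun γ => ?_
  rw [mul_apply, conv_units_left support_one, one_apply, Set.indicator_of_mem (show rng γ ∈ units G from ⟨γ, rfl⟩),
    Pi.one_apply, one_mul]

lemma add_mul' (f g h : ConvAlg G) : (f + g) * h = f * h + g * h :=
  ext fun γ => conv_add_left f g h γ

lemma mul_add' (f g h : ConvAlg G) : f * (g + h) = f * g + f * h :=
  ext fun γ => conv_add_right f g h γ

lemma smul_mul' (c : ℂ) (f g : ConvAlg G) : (c • f) * g = c • (f * g) := by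
  refine ext fun γ => ?_
  rw [smul_apply, mul_apply, mul_apply, conv_eq, conv_eq, mul_finsum_mem]
  exact finsum_mem_congr rfl fun α _ => by rw [smul_apply, mul_assoc]

lemma mul_smul' (c : ℂ) (f g : ConvAlg G) : f * (c • g) = c • (f * g) := by
  refine ext fun γ => ?_
  rw [smul_apply, mul_apply, mul_apply, conv_eq, conv_eq, mul_finsum_mem]
  exact finsum_mem_congr rfl fun α _ => by rw [smul_apply, mul_left_comm]

lemma star_add' (f g : ConvAlg G) : star (f + g) = star f + star g :=
  ext fun γ => star_add (f γ⁻¹) (g γ⁻¹)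

/-- `C_c(G)` with convolution; its unit is the characteristic function of the unit space. -/
noncomputable instance : Ring (ConvAlg G) :=
  { (inferInstance : AddCommGroup (ConvAlg G)) with
    mul := (· * ·)
    one := 1
    mul_assoc := fun f g h => ext fun γ => conv_assoc f g h γ
    one_mul := one_mul'
    mul_one := fun f => by
      have := congrArg star (one_mul' (star f))
      rwa [star_mul', star_star', star_one'] at this
    left_distrib := mul_add'
    right_distrib := add_mul'
    zero_mul := fun f => by
      have := add_mul' 0 0 f
      rwa [add_zero, left_eq_add] at this
    mul_zero := fun f => by
      have := mul_add' f 0 0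
      rwa [add_zero, left_eq_add] at this }

noncomputable instance : Algebra ℂ (ConvAlg G) := Algebra.ofModule smul_mul' mul_smul'

noncomputable instance : StarRing (ConvAlg G) where
  star_involutive := star_star'
  star_mul := star_mul'
  star_add := star_add'

instance : StarModule ℂ (ConvAlg G) where
  star_smul c f := ext fun γ => by
    rw [smul_apply, star_apply, smul_apply, star_apply, star_mul, mul_comm]

/-- Auxiliary: `M² - f^* ⋆ f` is of the form `h^* ⋆ h` when `f` lives on a bisection. -/
lemma exists_sq_complement (f : ConvAlg G) {U : Set G} (hU : IsBisection U)
    (hf : Function.support f ⊆ U) :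
    ∃ (M : ℝ) (h : ConvAlg G), 0 ≤ M ∧
      star f * f + star h * h = star ((M : ℂ) • (1 : ConvAlg G)) * ((M : ℂ) • (1 : ConvAlg G)) := by
  obtain ⟨M₀, hM₀⟩ := f.hasCompactSupport.exists_bound_of_continuous f.continuous
  set M := max M₀ 0 with hMdef
  have hM : ∀ x, ‖f x‖ ≤ M := fun x => (hM₀ x).trans (le_max_left _ _)
  have hM0 : 0 ≤ M := le_max_right _ _
  have hsupp : Function.support (star f : ConvAlg G) ⊆ {α | α⁻¹ ∈ U} := fun α hα =>
    hf (star_ne_zero.1 (show star (f α⁻¹) ≠ 0 from hα))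
  have hinj : InjOn rng {α : G | α⁻¹ ∈ U} := fun α hα β hβ h =>
    (invHomeo G).injective (hU.2 hα hβ ((src_inv α).trans (h.trans (src_inv β).symm)))
  have hmem : ∀ γ : G, ∀ β ∈ U, src β = rng γ → (star f * f) γ = star (f β) * f (β * γ) := by
    intro γ β hβ h
    have hβ' : β⁻¹ ∈ {α : G | α⁻¹ ∈ U} := by
      change β⁻¹⁻¹ ∈ U
      rwa [inv_inv_eq]
    rw [mul_apply, conv_of_injOn hinj hsupp hβ' ((rng_inv β).trans h), star_apply, inv_inv_eq]
  have hnot : ∀ γ : G, (¬ ∃ β ∈ U, src β = rng γ) → (star f * f) γ = 0 := by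
    intro γ h
    refine conv_of_notMem hsupp ?_
    rintro ⟨α, hα, h'⟩
    exact h ⟨α⁻¹, hα, (src_inv α).trans h'⟩
  have hA : ∀ γ ∉ units G, (star f * f) γ = 0 := by
    intro γ hγ
    by_cases h : ∃ β ∈ U, src β = rng γ
    · obtain ⟨β, hβ, h⟩ := h
      rw [hmem γ β hβ h]
      by_contra h0
      have h1 : β * γ ∈ U := hf (right_ne_zero_of_mul h0)
      have h2 : β * γ = β := hU.1 h1 hβ (rng_mul h)
      refine hγ ⟨src β, ?_⟩
      rw [rng_src, ← inv_comp_cancel_left h, h2, inv_comp]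
    · exact hnot γ h
  have hB : ∀ γ ∈ units G, ∃ t : ℝ, (star f * f) γ = t ∧ t ≤ M ^ 2 := by
    intro γ hγ
    by_cases h : ∃ β ∈ U, src β = rng γ
    · obtain ⟨β, hβ, h⟩ := h
      refine ⟨‖f β‖ ^ 2, ?_, pow_le_pow_left₀ (norm_nonneg _) (hM β) 2⟩
      rw [hmem γ β hβ h, ← mem_units_iff.1 hγ, ← h, mul_src_self, Complex.ofReal_pow]
      exact Complex.conj_mul' (f β)
    · exact ⟨0, by rw [hnot γ h, Complex.ofReal_zero], sq_nonneg M⟩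
  let h : ConvAlg G :=
    { toFun := (units G).indicator fun γ => ((Real.sqrt (M ^ 2 - ((star f * f) γ).re) : ℝ) : ℂ)
      continuous_toFun := by
        refine Continuous.indicator ?_ ?_
        · simp [(show IsClopen (units G) from ⟨isClosed_units, isOpen_units⟩).frontier_eq]
        · exact Complex.continuous_ofReal.comp (Real.continuous_sqrt.comp
            (continuous_const.sub (Complex.continuous_re.comp (star f * f).continuous)))
      hasCompactSupport' := HasCompactSupport.intro isCompact_units
        fun _ hx => Set.indicator_of_notMem hx _ }
  have hh : ∀ γ, h γ =
      (units G).indicator (fun γ => ((Real.sqrt (M ^ 2 - ((star f * f) γ).re) : ℝ) : ℂ)) γ :=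
    fun _ => rfl
  have hhs : Function.support (star h : ConvAlg G) ⊆ units G := by
    intro γ hγ
    have h1 : h γ⁻¹ ≠ 0 := star_ne_zero.1 (show star (h γ⁻¹) ≠ 0 from hγ)
    have h2 : γ⁻¹ ∈ units G := by
      by_contra h3
      exact h1 (by rw [hh, Set.indicator_of_notMem h3])
    rw [← inv_inv_eq γ, inv_of_mem_units h2]
    exact h2
  refine ⟨M, h, hM0, ext fun γ => ?_⟩
  rw [star_smul, star_one, smul_mul_assoc, one_mul, smul_smul, add_apply, smul_apply, one_apply,
    mul_apply (star h), conv_units_left hhs]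
  by_cases hγ : γ ∈ units G
  · obtain ⟨t, ht, htM⟩ := hB γ hγ
    rw [mem_units_iff.1 hγ, star_apply, inv_of_mem_units hγ, hh, Set.indicator_of_mem hγ,
      Set.indicator_of_mem hγ, ht, Complex.ofReal_re]
    simp only [RCLike.star_def, Complex.conj_ofReal, Pi.one_apply, mul_one]
    rw [← Complex.ofReal_mul, Real.mul_self_sqrt (by linarith)]
    push_cast
    ring
  · rw [hA γ hγ, hh γ, Set.indicator_of_notMem hγ, Set.indicator_of_notMem hγ]
    simp

/-- The values `‖ρ(f)‖`, where `ρ` runs through the *-representations of `C_c(G)` on Hilbert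
spaces. (Hilbert spaces in the universe of `G` suffice, since `C_c(G)` lives in it and every
representation is a direct sum of a zero representation and cyclic ones.) -/
def repNorms (f : ConvAlg G) : Set ℝ :=
  {x | ∃ (H : Type u) (_ : NormedAddCommGroup H) (_ : InnerProductSpace ℂ H) (_ : CompleteSpace H)
    (ρ : ConvAlg G →⋆ₙₐ[ℂ] (H →L[ℂ] H)), x = ‖ρ f‖}

lemma repNorms_bddAbove (f : ConvAlg G) : BddAbove (repNorms f) := by
  suffices h : ∃ C : ℝ, ∀ (H : Type u) [NormedAddCommGroup H] [InnerProductSpace ℂ H]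
      [CompleteSpace H] (ρ : ConvAlg G →⋆ₙₐ[ℂ] (H →L[ℂ] H)), ‖ρ f‖ ≤ C by
    obtain ⟨C, hC⟩ := h
    refine ⟨C, ?_⟩
    rintro x ⟨H, _, _, _, ρ, rfl⟩
    exact hC H ρ
  refine cc_induction (P := fun f : C_c(G, ℂ) => ∃ C : ℝ, ∀ (H : Type u) [NormedAddCommGroup H]
      [InnerProductSpace ℂ H] [CompleteSpace H] (ρ : ConvAlg G →⋆ₙₐ[ℂ] (H →L[ℂ] H)),
      ‖ρ (f : ConvAlg G)‖ ≤ C) ?_ ?_ ?_ f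
  · refine ⟨0, fun H _ _ _ ρ => ?_⟩
    have : ρ (0 : ConvAlg G) = 0 := map_zero ρ
    exact (congrArg norm this).trans norm_zero |>.le
  · rintro f g ⟨C, hC⟩ ⟨D, hD⟩
    refine ⟨C + D, fun H _ _ _ ρ => ?_⟩
    have : ρ ((f : ConvAlg G) + (g : ConvAlg G)) = ρ f + ρ g := map_add ρ _ _
    exact (congrArg norm this).le.trans ((norm_add_le _ _).trans (add_le_add (hC H ρ) (hD H ρ)))
  · intro f' U _ _ hU hf
    let f : ConvAlg G := f'
    change ∃ C : ℝ, ∀ (H : Type u) [NormedAddCommGroup H]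
      [InnerProductSpace ℂ H] [CompleteSpace H] (ρ : ConvAlg G →⋆ₙₐ[ℂ] (H →L[ℂ] H)), ‖ρ f‖ ≤ C
    obtain ⟨M, h, hM, heq⟩ := exists_sq_complement f hU hf
    refine ⟨M, fun H _ _ _ ρ => ?_⟩
    set P := ρ 1 with hP
    have hPP : star P * P = P := by
      rw [hP, ← map_star, ← map_mul, star_one, one_mul]
    have hP1 : ‖P‖ ≤ 1 := by
      have h1 : ‖P‖ * ‖P‖ = ‖P‖ := by rw [← CStarRing.norm_star_mul_self, hPP]
      nlinarith [norm_nonneg P]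
    have hop := congrArg ρ heq
    rw [map_add, map_mul, map_mul, map_mul, map_star, map_star, map_star, map_smul, ← hP] at hop
    refine ContinuousLinearMap.opNorm_le_bound _ hM fun x => ?_
    have key : ∀ T : H →L[ℂ] H, ‖T x‖ ^ 2 = RCLike.re (inner ℂ ((star T * T) x) x) := fun T =>
      ContinuousLinearMap.apply_norm_sq_eq_inner_adjoint_left T x
    have h2 : ‖(ρ (f : ConvAlg G)) x‖ ^ 2 + ‖(ρ h) x‖ ^ 2 = ‖((M : ℂ) • P) x‖ ^ 2 := by
      rw [key, key, key, ← hop, _root_.add_apply, inner_add_left, map_add]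
    have h3 : ‖((M : ℂ) • P) x‖ ≤ M * ‖x‖ := by
      rw [_root_.smul_apply, norm_smul, Complex.norm_real, Real.norm_of_nonneg hM]
      refine mul_le_mul_of_nonneg_left ?_ hM
      exact (P.le_opNorm x).trans (by nlinarith [norm_nonneg x])
    refine le_trans ?_ h3
    refine le_of_sq_le_sq ?_ (norm_nonneg _)
    nlinarith [sq_nonneg ‖(ρ h) x‖]

lemma repNorms_nonempty (f : ConvAlg G) : (repNorms f).Nonempty :=
  ⟨_, PUnit, inferInstance, inferInstance, inferInstance, 0, rfl⟩

lemma repNorms_le {f : ConvAlg G} {H : Type u} [NormedAddCommGroup H] [InnerProductSpace ℂ H]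
    [CompleteSpace H] (ρ : ConvAlg G →⋆ₙₐ[ℂ] (H →L[ℂ] H)) : ‖ρ f‖ ≤ sSup (repNorms f) :=
  le_csSup (repNorms_bddAbove f) ⟨H, _, _, _, ρ, rfl⟩

lemma sSup_repNorms_le {f : ConvAlg G} {C : ℝ}
    (h : ∀ (H : Type u) [NormedAddCommGroup H] [InnerProductSpace ℂ H] [CompleteSpace H]
      (ρ : ConvAlg G →⋆ₙₐ[ℂ] (H →L[ℂ] H)), ‖ρ f‖ ≤ C) : sSup (repNorms f) ≤ C := by
  refine csSup_le (repNorms_nonempty f) ?_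
  rintro x ⟨H, _, _, _, ρ, rfl⟩
  exact h H ρ

lemma sSup_repNorms_nonneg (f : ConvAlg G) : 0 ≤ sSup (repNorms f) :=
  (norm_nonneg _).trans (repNorms_le (0 : ConvAlg G →⋆ₙₐ[ℂ] (PUnit.{u+1} →L[ℂ] PUnit.{u+1})))

/-- The universal seminorm `‖f‖ = sup_ρ ‖ρ(f)‖` on `C_c(G)`. -/
noncomputable def maxSeminorm (G : Type u) [TopologicalSpace G] [ArrowGroupoid G] [AmpleGroupoid G]
    [CompactSpace (units G)] : RingSeminorm (ConvAlg G) where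
  toFun f := sSup (repNorms f)
  map_zero' := le_antisymm (sSup_repNorms_le fun H _ _ _ ρ => by simp) (sSup_repNorms_nonneg _)
  add_le' f g := sSup_repNorms_le fun H _ _ _ ρ => by
    rw [map_add]
    exact (norm_add_le _ _).trans (add_le_add (repNorms_le ρ) (repNorms_le ρ))
  neg' f := by
    refine le_antisymm (sSup_repNorms_le fun H _ _ _ ρ => ?_)
      (sSup_repNorms_le fun H _ _ _ ρ => ?_)
    · rw [map_neg, norm_neg]; exact repNorms_le ρ
    · rw [← norm_neg, ← map_neg]; exact repNorms_le ρ
  mul_le' f g := sSup_repNorms_le fun H _ _ _ ρ => by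
    rw [map_mul]
    exact (norm_mul_le _ _).trans
      (mul_le_mul (repNorms_le ρ) (repNorms_le ρ) (norm_nonneg _) (sSup_repNorms_nonneg _))

noncomputable instance : SeminormedRing (ConvAlg G) := (maxSeminorm G).toSeminormedRing

lemma norm_def (f : ConvAlg G) : ‖f‖ = sSup (repNorms f) := rfl

noncomputable instance : NormedAlgebra ℂ (ConvAlg G) where
  norm_smul_le c f := sSup_repNorms_le fun H _ _ _ ρ => by
    rw [map_smul, norm_smul]
    exact mul_le_mul_of_nonneg_left (repNorms_le ρ) (norm_nonneg c)

lemma norm_star_le (f : ConvAlg G) : ‖star f‖ ≤ ‖f‖ := sSup_repNorms_le fun H _ _ _ ρ => by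
  rw [map_star, norm_star]; exact repNorms_le ρ

instance : NormedStarGroup (ConvAlg G) where
  norm_star_le := norm_star_le

lemma norm_mul_self_le (f : ConvAlg G) : ‖f‖ * ‖f‖ ≤ ‖star f * f‖ := by
  have h : ‖f‖ ≤ Real.sqrt ‖star f * f‖ := sSup_repNorms_le fun H _ _ _ ρ => by
    refine Real.le_sqrt_of_sq_le ?_
    rw [sq, ← CStarRing.norm_star_mul_self, ← map_star, ← map_mul]
    exact repNorms_le ρ
  have h2 := mul_self_le_mul_self (norm_nonneg f) h
  rwa [Real.mul_self_sqrt (norm_nonneg _)] at h2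

end Ring

end ConvAlg

open UniformSpace in
/-- The full groupoid C*-algebra `C*(G)`: the (Hausdorff) completion of `C_c(G)` in the universal
seminorm. -/
def FullCStar (G : Type u) [TopologicalSpace G] [ArrowGroupoid G] [AmpleGroupoid G]
    [CompactSpace (units G)] : Type u :=
  Completion (ConvAlg G)

namespace FullCStar

open UniformSpace

variable {G : Type u} [TopologicalSpace G] [ArrowGroupoid G] [AmpleGroupoid G]
  [CompactSpace (units G)]

noncomputable instance : NormedRing (FullCStar G) := inferInstanceAs (NormedRing (Completion _))

noncomputable instance : Algebra ℂ (FullCStar G) :=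
  inferInstanceAs (Algebra ℂ (Completion (ConvAlg G)))

noncomputable instance : NormedAlgebra ℂ (FullCStar G) where
  norm_smul_le := norm_smul_le (α := ℂ) (β := Completion (ConvAlg G))

instance : CompleteSpace (FullCStar G) := inferInstanceAs (CompleteSpace (Completion _))

/-- The canonical map `C_c(G) → C*(G)`. -/
noncomputable def ofCc (f : ConvAlg G) : FullCStar G := ((f : ConvAlg G) : Completion (ConvAlg G))

lemma denseRange_ofCc : DenseRange (ofCc : ConvAlg G → FullCStar G) := Completion.denseRange_coe

lemma norm_ofCc (f : ConvAlg G) : ‖ofCc f‖ = ‖f‖ := Completion.norm_coe f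
lemma ofCc_add (f g : ConvAlg G) : ofCc (f + g) = ofCc f + ofCc g := Completion.coe_add f g
lemma ofCc_mul (f g : ConvAlg G) : ofCc (f * g) = ofCc f * ofCc g := Completion.coe_mul f g
lemma ofCc_smul (c : ℂ) (f : ConvAlg G) : ofCc (c • f) = c • ofCc f := Completion.coe_smul c f
lemma ofCc_one : ofCc (1 : ConvAlg G) = 1 := rfl

/-- The involution of `C*(G)` extends that of `C_c(G)` continuously. -/
noncomputable instance : Star (FullCStar G) where
  star := Completion.map (star : ConvAlg G → ConvAlg G)

lemma continuous_star' : Continuous (star : FullCStar G → FullCStar G) :=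
  Completion.continuous_map

lemma star_ofCc (f : ConvAlg G) : star (ofCc f) = ofCc (star f) :=
  Completion.map_coe (star_isometry (E := ConvAlg G)).uniformContinuous f

lemma induction {p : FullCStar G → Prop} (hp : IsClosed {a | p a}) (h : ∀ f, p (ofCc f))
    (a : FullCStar G) : p a := Completion.induction_on a hp h

lemma induction₂ {p : FullCStar G → FullCStar G → Prop}
    (hp : IsClosed {x : FullCStar G × FullCStar G | p x.1 x.2})
    (h : ∀ f g, p (ofCc f) (ofCc g)) (a b : FullCStar G) : p a b :=
  Completion.induction_on₂ a b hp h

noncomputable instance : StarRing (FullCStar G) where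
  star_involutive := induction
    (isClosed_eq (continuous_star'.comp continuous_star') continuous_id)
    fun f => by rw [star_ofCc, star_ofCc, star_star]
  star_mul := induction₂
    (isClosed_eq (continuous_star'.comp continuous_mul)
      ((continuous_star'.comp continuous_snd).mul (continuous_star'.comp continuous_fst)))
    fun f g => by simp only [← ofCc_mul, star_ofCc, star_mul]
  star_add := induction₂
    (isClosed_eq (continuous_star'.comp continuous_add)
      ((continuous_star'.comp continuous_fst).add (continuous_star'.comp continuous_snd)))
    fun f g => by simp only [← ofCc_add, star_ofCc, star_add]

instance : StarModule ℂ (FullCStar G) where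
  star_smul c := induction
    (isClosed_eq (continuous_star'.comp (continuous_const_smul c))
      (continuous_star'.const_smul (star c)))
    fun f => by simp only [← ofCc_smul, star_ofCc, star_smul]

instance : CStarRing (FullCStar G) where
  norm_mul_self_le := induction
    (isClosed_le (continuous_norm.mul continuous_norm)
      (continuous_norm.comp (continuous_star'.mul continuous_id)))
    fun f => by
      simp only [star_ofCc, ← ofCc_mul, norm_ofCc]
      exact ConvAlg.norm_mul_self_le f

noncomputable instance : CStarAlgebra (FullCStar G) where

/-- The order of a C*-algebra: `a ≤ b` iff `b - a` is positive. -/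
noncomputable instance : PartialOrder (FullCStar G) := CStarAlgebra.spectralOrder _

instance : StarOrderedRing (FullCStar G) := CStarAlgebra.spectralOrderedRing _

end FullCStar

/-- The topological full group `[[G]]`: the compact open bisections `U` with
`r(U) = s(U) = G⁽⁰⁾`. -/
structure TopFullGroup (G : Type*) [TopologicalSpace G] [ArrowGroupoid G] where
  carrier : Set G
  isOpen : IsOpen carrier
  isCompact : IsCompact carrier
  isBisection : IsBisection carrier
  image_rng : rng '' carrier = units G
  image_src : src '' carrier = units G

/-- The element `1_U` of `C*(G)`, for `U ∈ [[G]]`. -/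
noncomputable def TopFullGroup.toFullCStar {G : Type u} [TopologicalSpace G] [ArrowGroupoid G]
    [AmpleGroupoid G] [CompactSpace (units G)] (U : TopFullGroup G) : FullCStar G :=
  FullCStar.ofCc (ConvAlg.ind U.carrier U.isOpen U.isCompact)

/-- A hereditary C*-subalgebra: a closed *-subalgebra `B` such that `0 ≤ a ≤ b` and `b ∈ B` imply
`a ∈ B`. -/
def IsHereditaryCStarSubalgebra {A : Type*} [CStarAlgebra A] [PartialOrder A] [StarOrderedRing A]
    (B : NonUnitalStarSubalgebra ℂ A) : Prop :=
  IsClosed (B : Set A) ∧ ∀ a b : A, 0 ≤ a → a ≤ b → b ∈ B → a ∈ B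

/-! Let `B` be the closed span of the elements `1 - 1_U`. It is a closed *-subalgebra because `g (1
- k) = g - g k` is a difference of elements of `[[G]]`: the span is an augmentation ideal. A closed
*-subalgebra is hereditary as soon as `B A B ⊆ B`
(`NonUnitalStarSubalgebra.isHereditary_of_mul_mul_mem`), so by linearity and continuity everything
reduces to `(1 - u) f (1 - w) ∈ B` for `u, w` in `[[G]]` and `f` in `C_c(G)`.

The question is local in `f`. Near an arrow `γ` write `f = g h`, with `g` in `[[G]]` containing `γ`
and `h` a function on units near `x = s(γ)`. Since `(1 - u) g = (1 - u g) - (1 - g)`, only `(1 - u)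
h (1 - w)` matters, and `h` is a uniform limit of combinations of projections `e = 1_V`, with `V` a
small clopen set of units near `x`.

Three points of an orbit are what makes `(1 - u) e (1 - w)` an algebraic combination of differences.
Let `b`, `c` in `[[G]]` move `x` to `y` and `t`, with `x, y, t` distinct. For small `e` the
projections `e`, `b e b*`, `c e c*` are orthogonal and behave like the diagonal of a 3 × 3 matrix
algebra, where `(1 - b) e (1 - c*)` is `(E₁₁ - E₂₁)(E₁₁ - E₁₃) = (E₁₁ + E₂₃ + E₃₂) - (E₂₁ + E₃₂ +
E₁₃)`, a difference of two permutation matrices (`one_sub_mul_mul_one_sub_star`). These extend by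
the identity to elements of `[[G]]`.

Arbitrary `u` and `w` are brought to this case by multiplying with `[[G]]` from outside: some `v` in
`[[G]]` fixes `V` and carries `b V` to `u V`, so `(1 - u) e = v (1 - b) e`, with detours when `u x`
is `x` or `y` (`forSmallProj_mem_leftSpan`). -/

/-! ### Symmetries exchanging two orthogonal projections in a *-ring. -/

section PartialSwap

variable {R : Type*} [Ring R] [StarRing R]

/-- For a projection `e` and `u` with `u* u e = e` and `e u e = 0`, the symmetry exchanging the orthogonal
projections `e` and `u e u*` by means of `u`. -/
def partialSwap (u e : R) : R := u * e + e * star u + 1 - e - u * e * star u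

lemma star_partialSwap {u e : R} (he : star e = e) : star (partialSwap u e) = partialSwap u e := by
  simp only [partialSwap, star_sub, star_add, star_mul, star_one, star_star, he, mul_assoc]
  abel

lemma partialSwap_mul_of_orthogonal {u e x : R} (h1 : e * x = 0) (h2 : e * star u * x = 0) :
    partialSwap u e * x = x := by
  rw [mul_assoc] at h2
  simp only [partialSwap, add_mul, sub_mul, mul_assoc, h1, h2, mul_zero, one_mul]
  abel

lemma mul_star_mul_eq_zero {u e : R} (he : star e = e) (h : e * u * e = 0) :
    e * star u * e = 0 := by
  have := congrArg star h
  simpa only [star_mul, star_zero, he, mul_assoc] using this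

lemma partialSwap_mul_self_right {u e : R} (hee : e * e = e) (he : star e = e)
    (h : e * u * e = 0) : partialSwap u e * e = u * e := by
  have h2 := mul_star_mul_eq_zero he h
  rw [mul_assoc] at h2
  simp only [partialSwap, add_mul, sub_mul, mul_assoc, hee, h2, mul_zero, one_mul]
  abel

lemma partialSwap_mul_image {u e : R} (hu : star u * u * e = e) (hee : e * e = e)
    (h : e * u * e = 0) : partialSwap u e * (u * e) = e := by
  have h2 : star u * (u * e) = e := by rw [← mul_assoc, hu]
  have h3 : e * (u * e) = 0 := by rw [← mul_assoc, h]
  simp only [partialSwap, add_mul, sub_mul, mul_assoc, hee, h2, h3, mul_zero, one_mul]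
  abel

lemma partialSwap_mul_partialSwap {u e : R} (hu : star u * u * e = e) (hee : e * e = e)
    (he : star e = e) (h : e * u * e = 0) : partialSwap u e * partialSwap u e = 1 := by
  have h1 := partialSwap_mul_self_right hee he h
  have h2 := partialSwap_mul_image hu hee h
  have h3 : partialSwap u e * (u * e * star u) = e * star u := by rw [← mul_assoc, h2]
  have h4 : partialSwap u e * (e * star u) = u * e * star u := by rw [← mul_assoc, h1]
  nth_rewrite 2 [partialSwap]
  rw [mul_sub, mul_sub, mul_add, mul_add, h1, h2, h3, h4, mul_one]
  rw [partialSwap]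
  abel

lemma partialSwap_mul_of_orthogonal_image {u e v : R} (h1 : e * v * e = 0)
    (h2 : e * star u * v * e = 0) : partialSwap u e * (v * e) = v * e :=
  partialSwap_mul_of_orthogonal (by rw [← mul_assoc, h1]) (by rw [← mul_assoc, h2])

/-- A corner of three mutually orthogonal projections `e`, `b e b*`, `c e c*`: a difference of two
permutation matrices there is an elementary tensor. -/
lemma one_sub_mul_mul_one_sub_star {b c e : R} (hb : star b * b * e = e) (hee : e * e = e) (he : star e = e) (hbe : e * b * e = 0) (hce : e * c * e = 0)
    (hbc : e * star b * c * e = 0) :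
    (1 - b) * e * (1 - star c) =
      partialSwap b e * (partialSwap c e * partialSwap b e) - partialSwap c e * partialSwap b e := by
  have hcb : e * star c * b * e = 0 := by
    have := congrArg star hbc
    simpa only [star_mul, star_zero, he, star_star, mul_assoc] using this
  have hs : 1 - partialSwap b e = (1 - b) * e * (1 - star b) := by
    rw [partialSwap]
    noncomm_ring
  have h1 : e * partialSwap c e = e * star c := by
    have := congrArg star (partialSwap_mul_self_right hee he hce)
    simpa only [star_mul, star_partialSwap he, he] using this
  have h2 : e * star b * partialSwap c e = e * star b := by
    have := congrArg star (partialSwap_mul_of_orthogonal_image (u := c) hbe hcb)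
    simpa only [star_mul, star_partialSwap he, he] using this
  have h3 : e * star c * partialSwap b e = e * star c := by
    have := congrArg star (partialSwap_mul_of_orthogonal_image (u := b) hce hbc)
    simpa only [star_mul, star_partialSwap he, he] using this
  have h4 : e * star b * partialSwap b e = e := by
    have := congrArg star (partialSwap_mul_image hb hee hbe)
    simpa only [star_mul, star_partialSwap he, he] using this
  -- By `hs` the claimed difference is `-(1 - b) e (1 - b*)` times the two swaps; the swaps, acting
  -- from the right, turn the row `e - e b*` into `e c* - e b*` and then into `e c* - e`.
  have h5 : (1 - partialSwap b e) * (partialSwap c e * partialSwap b e) =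
      (1 - b) * (e * star c - e) := by
    rw [hs, mul_assoc (1 - b), mul_assoc (1 - b)]
    congr 1
    rw [← mul_assoc, mul_sub e, mul_one, sub_mul e, h1, h2, sub_mul, h3, h4]
  rw [sub_mul, one_mul] at h5
  rw [← neg_sub (partialSwap c e * partialSwap b e), h5]
  noncomm_ring

end PartialSwap

/-! ### Bisections, the full group and clopen sets of units as functions with values 0 and 1. -/

namespace ConvAlg

variable {G : Type u} [TopologicalSpace G] [ArrowGroupoid G] [AmpleGroupoid G]
  [CompactSpace (units G)]

/-- Functions with values in `{0, 1}`. -/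
def IsZeroOne (f : ConvAlg G) : Prop := ∀ γ, f γ = 0 ∨ f γ = 1

/-- Characteristic functions of compact open bisections. -/
structure IsPartial (f : ConvAlg G) : Prop where
  zeroOne : IsZeroOne f
  injRng : ∀ ⦃α β⦄, f α = 1 → f β = 1 → rng α = rng β → α = β
  injSrc : ∀ ⦃α β⦄, f α = 1 → f β = 1 → src α = src β → α = β

/-- Characteristic functions of elements of the topological full group, described as the unitaries
with values in `{0, 1}`. -/
structure IsFull (f : ConvAlg G) : Prop where
  zeroOne : IsZeroOne f
  star_mul_self : star f * f = 1
  mul_star_self : f * star f = 1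

/-- Characteristic functions of clopen sets of units. -/
structure IsUnitProj (e : ConvAlg G) : Prop where
  zeroOne : IsZeroOne e
  mem_units : ∀ ⦃γ⦄, e γ ≠ 0 → γ ∈ units G

lemma IsZeroOne.eq_one {f : ConvAlg G} (hf : IsZeroOne f) {γ : G} (h : f γ ≠ 0) : f γ = 1 :=
  (hf γ).resolve_left h

lemma IsZeroOne.star {f : ConvAlg G} (hf : IsZeroOne f) : IsZeroOne (star f) := fun γ => by
  rw [star_apply]
  rcases hf γ⁻¹ with h | h <;> simp [h]

lemma star_apply_eq_one {f : ConvAlg G} {γ : G} : star f γ = 1 ↔ f γ⁻¹ = 1 := by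
  rw [star_apply]
  exact star_eq_iff_star_eq.trans (by rw [star_one, eq_comm])

lemma star_apply_ne_zero {f : ConvAlg G} {γ : G} : star f γ ≠ 0 ↔ f γ⁻¹ ≠ 0 := by
  rw [star_apply]
  exact star_ne_zero

lemma isZeroOne_one : IsZeroOne (1 : ConvAlg G) := fun γ => by
  rw [one_apply]
  by_cases h : γ ∈ units G <;> simp [h]

lemma one_apply_of_mem {γ : G} (h : γ ∈ units G) : (1 : ConvAlg G) γ = 1 := by
  rw [one_apply, Set.indicator_of_mem h, Pi.one_apply]

lemma one_apply_of_notMem {γ : G} (h : γ ∉ units G) : (1 : ConvAlg G) γ = 0 := by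
  rw [one_apply, Set.indicator_of_notMem h]

lemma rng_mem_units (γ : G) : rng γ ∈ units G := ⟨γ, rfl⟩

lemma src_mem_units (γ : G) : src γ ∈ units G := ⟨src γ, rng_src γ⟩

lemma sub_apply (f g : ConvAlg G) (x : G) : (f - g) x = f x - g x := rfl

lemma IsPartial.star {f : ConvAlg G} (hf : IsPartial f) : IsPartial (star f) where
  zeroOne := hf.zeroOne.star
  injRng α β hα hβ h := (invHomeo G).injective
    (hf.injSrc (star_apply_eq_one.1 hα) (star_apply_eq_one.1 hβ) ((src_inv α).trans (h.trans (src_inv β).symm)))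
  injSrc α β hα hβ h := (invHomeo G).injective
    (hf.injRng (star_apply_eq_one.1 hα) (star_apply_eq_one.1 hβ) ((rng_inv α).trans (h.trans (rng_inv β).symm)))

lemma IsPartial.mul_apply {f : ConvAlg G} (hf : IsPartial f) (g : ConvAlg G) {α γ : G}
    (hα : f α = 1) (h : rng α = rng γ) : (f * g) γ = g (α⁻¹ * γ) := by
  rw [ConvAlg.mul_apply, conv_of_injOn (U := Function.support f) (fun a ha b hb hab => hf.injRng
    (hf.zeroOne.eq_one ha) (hf.zeroOne.eq_one hb) hab) subset_rfl
    (by rw [Function.mem_support, hα]; exact one_ne_zero) h, hα, one_mul]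

lemma exists_of_mul_apply_ne_zero {f g : ConvAlg G} {γ : G} (h : (f * g) γ ≠ 0) :
    ∃ α β, f α ≠ 0 ∧ g β ≠ 0 ∧ src α = rng β ∧ α * β = γ := by
  by_contra! hc
  refine h (finsum_mem_of_eqOn_zero ?_)
  rintro ⟨α, β⟩ ⟨h1, h2⟩
  by_contra h0
  exact hc α β (left_ne_zero_of_mul h0) (right_ne_zero_of_mul h0) h1 h2

lemma IsPartial.isZeroOne_mul {f g : ConvAlg G} (hf : IsPartial f) (hg : IsZeroOne g) :
    IsZeroOne (f * g) := fun γ => by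
  by_cases h : (f * g) γ = 0
  · exact Or.inl h
  · obtain ⟨α, β, hα, -, hs, rfl⟩ := exists_of_mul_apply_ne_zero h
    rw [hf.mul_apply g (hf.zeroOne.eq_one hα) (rng_mul hs).symm]
    exact hg _

lemma IsUnitProj.mul_apply {e : ConvAlg G} (he : IsUnitProj e) (f : ConvAlg G) (γ : G) :
    (e * f) γ = e (rng γ) * f γ :=
  conv_units_left (fun _ h => he.mem_units h) γ

lemma IsUnitProj.star_eq {e : ConvAlg G} (he : IsUnitProj e) : star e = e := by
  refine ext fun γ => ?_
  have key : ∀ γ, e γ = 1 → star e γ = 1 := fun γ h => by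
    rw [star_apply_eq_one, inv_of_mem_units (he.mem_units (by rw [h]; exact one_ne_zero)), h]
  rcases he.zeroOne γ with h | h
  · rcases he.zeroOne.star γ with h' | h'
    · rw [h, h']
    · have := key _ (star_apply_eq_one.1 h')
      rw [star_apply_eq_one, inv_inv_eq] at this
      rw [h', this]
  · rw [h, key γ h]

lemma IsUnitProj.apply_mul {e : ConvAlg G} (he : IsUnitProj e) (f : ConvAlg G) (γ : G) :
    (f * e) γ = f γ * e (src γ) := by
  have h : f * e = star (e * star f) := by rw [star_mul, star_star, he.star_eq]
  have h' : star (e (src γ)) = e (src γ) := by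
    rcases he.zeroOne (src γ) with h | h <;> simp [h]
  rw [h, star_apply, he.mul_apply, rng_inv, star_apply, inv_inv_eq, StarMul.star_mul, star_star, h']

lemma IsUnitProj.mul_self {e : ConvAlg G} (he : IsUnitProj e) : e * e = e := by
  refine ext fun γ => ?_
  rw [he.mul_apply]
  by_cases h : e γ = 0
  · rw [h, mul_zero]
  · rw [mem_units_iff.1 (he.mem_units h), he.zeroOne.eq_one h, mul_one]

lemma IsUnitProj.mul {e e' : ConvAlg G} (he : IsUnitProj e) (he' : IsUnitProj e') :
    IsUnitProj (e * e') where
  zeroOne γ := by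
    rw [he.mul_apply]
    rcases he.zeroOne (rng γ) with h | h <;> rcases he'.zeroOne γ with h' | h' <;> simp [h, h']
  mem_units γ h := by
    rw [he.mul_apply] at h
    exact he'.mem_units (right_ne_zero_of_mul h)

lemma isFull_one : IsFull (1 : ConvAlg G) :=
  ⟨isZeroOne_one, by rw [star_one, one_mul], by rw [star_one, one_mul]⟩

lemma IsFull.star {f : ConvAlg G} (hf : IsFull f) : IsFull (star f) :=
  ⟨hf.zeroOne.star, by rw [star_star, hf.mul_star_self], by rw [star_star, hf.star_mul_self]⟩

/-- For `α` with range `x` one has `α⁻¹ x = α⁻¹`, so the convolution sum is `∑ |f(α⁻¹)|²` and counts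
the arrows of `f` with source `x`. Hence `f* f = 1` forces exactly one arrow over each unit. -/
lemma star_mul_self_apply {f : ConvAlg G} (hf : IsZeroOne f) {x : G} (hx : x ∈ units G) :
    (star f * f) x = (({α : G | rng α = x} ∩ {α | f α⁻¹ = 1}).ncard : ℂ) := by
  rw [ConvAlg.mul_apply, conv_eq, mem_units_iff.1 hx]
  have h0 : ∀ α, rng α = x → α⁻¹ * x = α⁻¹ := by
    rintro α rfl
    rw [← src_inv α, mul_src_self]
  have hfin : ({α : G | rng α = x} ∩ {α | f α⁻¹ = 1}).Finite :=
    (finite_fibre (star f : ConvAlg G) x).subset fun α hα =>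
      ⟨hα.1, star_apply_ne_zero.2 (by rw [hα.2.out]; exact one_ne_zero)⟩
  rw [finsum_mem_eq_sum_of_inter_support_eq (t := hfin.toFinset), Finset.sum_congr rfl (g := fun _ => 1),
    Finset.sum_const, nsmul_eq_mul, mul_one, Set.ncard_eq_toFinset_card _ hfin]
  · intro α hα
    rw [Finite.mem_toFinset] at hα
    rw [h0 α hα.1, star_apply, hα.2.out, star_one, mul_one]
  · ext α
    simp only [mem_inter_iff, mem_ofPred_eq, Function.mem_support, Finite.coe_toFinset]
    constructor
    · rintro ⟨h1, h2⟩
      rw [h0 α h1] at h2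
      have := hf.eq_one (right_ne_zero_of_mul h2)
      exact ⟨⟨h1, this⟩, by rwa [h0 α h1]⟩
    · rintro ⟨⟨h1, -⟩, h3⟩
      exact ⟨h1, h3⟩

lemma IsFull.existsUnique_rng {f : ConvAlg G} (hf : IsFull f) {x : G} (hx : x ∈ units G) :
    ∃ α, ({α : G | rng α = x} ∩ {α | f α⁻¹ = 1}) = {α} := by
  have h := star_mul_self_apply hf.zeroOne hx
  rw [hf.star_mul_self, one_apply_of_mem hx] at h
  exact Set.ncard_eq_one.1 (by exact_mod_cast h.symm)

lemma IsFull.exists_src {f : ConvAlg G} (hf : IsFull f) {x : G} (hx : x ∈ units G) :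
    ∃ α, f α = 1 ∧ src α = x := by
  obtain ⟨α, hα⟩ := hf.existsUnique_rng hx
  have : α ∈ ({α : G | rng α = x} ∩ {α | f α⁻¹ = 1}) := by rw [hα]; rfl
  exact ⟨α⁻¹, this.2, (src_inv α).trans this.1⟩

lemma IsFull.eq_of_src {f : ConvAlg G} (hf : IsFull f) ⦃α β : G⦄ (hα : f α = 1) (hβ : f β = 1)
    (h : src α = src β) : α = β := by
  obtain ⟨δ, hδ⟩ := hf.existsUnique_rng (src_mem_units α)
  have h1 : α⁻¹ ∈ ({δ : G | rng δ = src α} ∩ {α | f α⁻¹ = 1}) :=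
    ⟨rng_inv α, by rwa [mem_ofPred_eq, inv_inv_eq]⟩
  have h2 : β⁻¹ ∈ ({δ : G | rng δ = src α} ∩ {α | f α⁻¹ = 1}) :=
    ⟨(rng_inv β).trans h.symm, by rwa [mem_ofPred_eq, inv_inv_eq]⟩
  rw [hδ] at h1 h2
  exact (invHomeo G).injective (h1.out.trans h2.out.symm)

lemma IsFull.isPartial {f : ConvAlg G} (hf : IsFull f) : IsPartial f where
  zeroOne := hf.zeroOne
  injSrc := hf.eq_of_src
  injRng α β hα hβ h := by
    refine (invHomeo G).injective (hf.star.eq_of_src ?_ ?_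
      ((src_inv α).trans (h.trans (src_inv β).symm)))
    · rw [star_apply_eq_one]
      exact (congrArg f (inv_inv_eq α)).trans hα
    · rw [star_apply_eq_one]
      exact (congrArg f (inv_inv_eq β)).trans hβ

lemma IsFull.mul {f g : ConvAlg G} (hf : IsFull f) (hg : IsFull g) : IsFull (f * g) where
  zeroOne := hf.isPartial.isZeroOne_mul hg.zeroOne
  star_mul_self := by
    rw [star_mul, mul_assoc, ← mul_assoc (Star.star f), hf.star_mul_self, one_mul, hg.star_mul_self]
  mul_star_self := by
    rw [star_mul, mul_assoc, ← mul_assoc g, hg.mul_star_self, one_mul, hf.mul_star_self]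

/-- Conjugates of unit projections by partial bisections. -/
lemma IsUnitProj.conj_apply_ne_zero {u e : ConvAlg G} (he : IsUnitProj e) (hu : IsPartial u)
    {γ : G} (h : (u * e * star u) γ ≠ 0) :
    γ ∈ units G ∧ ∃ α, u α = 1 ∧ rng α = γ ∧ e (src α) = 1 := by
  obtain ⟨α, β, hα, hβ, hs, rfl⟩ := exists_of_mul_apply_ne_zero h
  rw [he.apply_mul] at hα
  have h1 := hu.zeroOne.eq_one (left_ne_zero_of_mul hα)
  have h2 := hu.zeroOne.eq_one (star_apply_ne_zero.1 hβ)
  have h3 : α = β⁻¹ := hu.injSrc h1 h2 (by rw [src_inv, hs])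
  have h4 : α * β = rng α := by rw [h3, inv_comp, rng_inv]
  exact ⟨⟨α, h4.symm⟩, α, h1, h4.symm, he.zeroOne.eq_one (right_ne_zero_of_mul hα)⟩

lemma IsUnitProj.conj {u e : ConvAlg G} (he : IsUnitProj e) (hu : IsPartial u) :
    IsUnitProj (u * e * star u) where
  zeroOne := by
    rw [mul_assoc]
    refine hu.isZeroOne_mul fun γ => ?_
    rw [he.mul_apply]
    rcases he.zeroOne (rng γ) with h | h <;> rcases hu.zeroOne.star γ with h' | h' <;> simp [h, h']
  mem_units _ h := (he.conj_apply_ne_zero hu h).1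

/-- Unitarity is algebraic, since the swap is a self-adjoint square root of 1. What needs the
groupoid is that its values are 0 and 1: by `e u e = 0` the pieces `u e`, `e u*` and `1 - e - u e
u*` have disjoint supports. -/
lemma isFull_partialSwap {u e : ConvAlg G} (hu : IsPartial u) (he : IsUnitProj e)
    (hue : star u * u * e = e) (h : e * u * e = 0) : IsFull (partialSwap u e) := by
  have hs := star_partialSwap (u := u) he.star_eq
  have hm := partialSwap_mul_partialSwap hue he.mul_self he.star_eq h
  have hz : ∀ γ, u γ ≠ 0 → e (rng γ) ≠ 0 → e (src γ) ≠ 0 → False := by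
    intro γ h1 h2 h3
    have := DFunLike.congr_fun h γ
    rw [he.apply_mul, he.mul_apply] at this
    exact mul_ne_zero (mul_ne_zero h2 h1) h3 this
  refine ⟨fun γ => ?_, by rw [hs, hm], by rw [hs, hm]⟩
  have hval : partialSwap u e γ = u γ * e (src γ) + e (rng γ) * star u γ + (1 : ConvAlg G) γ - e γ -
      (u * e * star u) γ := by
    rw [partialSwap, sub_apply, sub_apply, add_apply, add_apply, he.apply_mul, he.mul_apply]
  rw [hval]
  -- On units only `1 - e - u e u*` survives, and `e` and `u e u*` cannot both be 1. Off the units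
  -- only `u e` and `e u*` survive; if both were 1 at `γ`, then `γ` would be an arrow of `u` with
  -- both ends in `e`.
  by_cases hγ : γ ∈ units G
  · have hr := mem_units_iff.1 hγ
    have hs := src_of_mem_units hγ
    have hi := inv_of_mem_units hγ
    have h1 : u γ * e γ = 0 := by
      by_contra hc
      exact hz γ (left_ne_zero_of_mul hc) (by rw [hr]; exact right_ne_zero_of_mul hc)
        (by rw [hs]; exact right_ne_zero_of_mul hc)
    have h2 : e γ * star u γ = 0 := by
      rw [star_apply, hi]
      rcases mul_eq_zero.1 h1 with h | h <;> simp [h]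
    rw [hr, hs, h1, h2, one_apply_of_mem hγ]
    rcases he.zeroOne γ with h3 | h3
    · rcases (he.conj hu).zeroOne γ with h4 | h4 <;> simp [h3, h4]
    · have h4 : (u * e * star u) γ = 0 := by
        by_contra h4
        obtain ⟨-, α, h5, h6, h7⟩ := he.conj_apply_ne_zero hu h4
        exact hz α (by simp [h5]) (by simp [h6, h3]) (by simp [h7])
      simp [h3, h4]
  · have h1 : e γ = 0 := by_contra fun h => hγ (he.mem_units h)
    have h2 : (u * e * star u) γ = 0 := by_contra fun h => hγ ((he.conj hu).mem_units h)
    rw [h1, h2, one_apply_of_notMem hγ]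
    rcases hu.zeroOne γ with h3 | h3 <;> rcases he.zeroOne (src γ) with h4 | h4 <;>
      rcases hu.zeroOne.star γ with h5 | h5 <;> rcases he.zeroOne (rng γ) with h6 | h6 <;>
      simp [h3, h4, h5, h6]
    exact hz γ (by simp [h3]) (by simp [h6]) (by simp [h4])

/-! ### Properties of all small projections near a unit. -/

/-- A property of all unit projections which live close to `x`. -/
def ForSmallProj (x : G) (P : ConvAlg G → Prop) : Prop :=
  ∃ N ∈ 𝓝 x, ∀ e : ConvAlg G, IsUnitProj e → (∀ γ, e γ ≠ 0 → γ ∈ N) → P e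

lemma ForSmallProj.and {x : G} {P Q : ConvAlg G → Prop} (hP : ForSmallProj x P)
    (hQ : ForSmallProj x Q) : ForSmallProj x fun e => P e ∧ Q e := by
  obtain ⟨N, hN, h⟩ := hP
  obtain ⟨N', hN', h'⟩ := hQ
  exact ⟨N ∩ N', Filter.inter_mem hN hN', fun e he hs =>
    ⟨h e he fun γ hγ => (hs γ hγ).1, h' e he fun γ hγ => (hs γ hγ).2⟩⟩

lemma ForSmallProj.mono {x : G} {P Q : ConvAlg G → Prop} (hP : ForSmallProj x P)
    (hPQ : ∀ e, IsUnitProj e → P e → Q e) : ForSmallProj x Q := by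
  obtain ⟨N, hN, h⟩ := hP
  exact ⟨N, hN, fun e he hs => hPQ e he (h e he hs)⟩

lemma exists_isUnitProj {x : G} (hx : x ∈ units G) {N : Set G} (hN : N ∈ 𝓝 x) :
    ∃ e : ConvAlg G, IsUnitProj e ∧ e x = 1 ∧ ∀ γ, e γ ≠ 0 → γ ∈ N := by
  have := AmpleGroupoid.totallyDisconnected_units (G := G)
  obtain ⟨O, hON, hO, hxO⟩ := mem_nhds_iff.1 hN
  obtain ⟨C, hC, hxC, hCO⟩ := compact_exists_isClopen_in_isOpen
    (hO.preimage (continuous_subtype_val (p := (· ∈ units G)))) (x := ⟨x, hx⟩) hxO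
  have hopen : IsOpen ((↑) '' C : Set G) := isOpen_units.isOpenMap_subtype_val _ hC.2
  have hcomp : IsCompact ((↑) '' C : Set G) := hC.1.isCompact.image continuous_subtype_val
  have hval : ∀ γ, ind _ hopen hcomp γ = ((↑) '' C : Set G).indicator 1 γ := fun _ => rfl
  have hmem : ∀ γ, ind _ hopen hcomp γ ≠ 0 → γ ∈ ((↑) '' C : Set G) := fun γ hγ => by
    by_contra h
    exact hγ (by rw [hval, Set.indicator_of_notMem h])
  refine ⟨ind _ hopen hcomp, ⟨fun γ => ?_, fun γ hγ => ?_⟩, ?_, fun γ hγ => ?_⟩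
  · rw [hval]
    by_cases h : γ ∈ ((↑) '' C : Set G)
    · right; rw [Set.indicator_of_mem h]; rfl
    · left; rw [Set.indicator_of_notMem h]
  · obtain ⟨c, -, rfl⟩ := hmem γ hγ
    exact c.2
  · rw [hval, Set.indicator_of_mem (show x ∈ ((↑) '' C : Set G) from ⟨_, hxC, rfl⟩)]; rfl
  · obtain ⟨c, hc, rfl⟩ := hmem γ hγ
    exact hON (hCO hc)

lemma ForSmallProj.exists {x : G} (hx : x ∈ units G) {P : ConvAlg G → Prop}
    (hP : ForSmallProj x P) : ∃ e, IsUnitProj e ∧ e x = 1 ∧ P e := by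
  obtain ⟨N, hN, h⟩ := hP
  obtain ⟨e, he, hex, hs⟩ := exists_isUnitProj hx hN
  exact ⟨e, he, hex, h e he hs⟩

lemma isOpenMap_src : IsOpenMap (src : G → G) :=
  isOpen_units.isOpenMap_subtype_val.comp AmpleGroupoid.isLocalHomeomorph_src.isOpenMap

/-- The bisection `u` maps the unit `x` to `y`. -/
def Moves (u : ConvAlg G) (x y : G) : Prop := ∃ γ, u γ = 1 ∧ src γ = x ∧ rng γ = y

lemma IsPartial.image_src_mem_nhds {f : ConvAlg G} {γ : G} (h : f γ = 1)
    {O : Set G} (hO : IsOpen O) (hγ : rng γ ∈ O) :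
    src '' ({α | f α ≠ 0} ∩ rng ⁻¹' O) ∈ 𝓝 (src γ) := by
  refine (isOpenMap_src _ ?_).mem_nhds ⟨γ, ⟨by simp [h], hγ⟩, rfl⟩
  exact (isOpen_ne_fun f.continuous continuous_const).inter (hO.preimage continuous_rng)

/-- Bisections which move `x` to different points have locally orthogonal ranges. -/
lemma forSmallProj_mul_star_mul_eq_zero {f g : ConvAlg G} (hf : IsPartial f) (hg : IsPartial g)
    {x y z : G} (hxy : Moves f x y) (hxz : Moves g x z) (hyz : y ≠ z) :
    ForSmallProj x fun e => e * star f * g * e = 0 := by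
  obtain ⟨α, hα, rfl, rfl⟩ := hxy
  obtain ⟨β, hβ, hs, rfl⟩ := hxz
  -- Shrink `e` so that `f` sends its support into `O` and `g` sends it into the disjoint set `O'`;
  -- a nonzero value of `e f* g e` would give arrows of `f` and `g` starting in that support with a
  -- common range.
  obtain ⟨O, O', hO, hO', hαO, hβO, hd⟩ := t2_separation hyz
  refine ⟨_, Filter.inter_mem (IsPartial.image_src_mem_nhds hα hO hαO)
    (hs ▸ IsPartial.image_src_mem_nhds hβ hO' hβO), fun e he hsupp => ext fun γ => ?_⟩
  rw [he.apply_mul, mul_assoc, he.mul_apply, zero_apply]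
  by_contra hc
  have h1 := left_ne_zero_of_mul (left_ne_zero_of_mul hc)
  have h3 := right_ne_zero_of_mul hc
  obtain ⟨δ, ε, hδ, hε, hδε, rfl⟩ := exists_of_mul_apply_ne_zero
    (right_ne_zero_of_mul (left_ne_zero_of_mul hc))
  rw [rng_mul hδε] at h1
  rw [src_mul hδε] at h3
  obtain ⟨δ', ⟨hδ', hO1⟩, hr1⟩ := (hsupp _ h1).1
  obtain ⟨ε', ⟨hε', hO2⟩, hr2⟩ := (hsupp _ h3).2
  have e1 : δ' = δ⁻¹ := hf.injSrc (hf.zeroOne.eq_one hδ')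
    (hf.zeroOne.eq_one (star_apply_ne_zero.1 hδ)) (by rw [hr1, src_inv])
  have e2 : ε' = ε := hg.injSrc (hg.zeroOne.eq_one hε') (hg.zeroOne.eq_one hε) hr2
  subst e2
  subst e1
  refine Set.disjoint_left.1 hd hO1 ?_
  rw [rng_inv, hδε]
  exact hO2

/-- For a bisection, `f* f` is the characteristic function of the set of sources of `f`, which is
open and contains `x`. -/
lemma forSmallProj_star_mul_self_mul {f : ConvAlg G} (hf : IsPartial f) {x y : G}
    (hxy : Moves f x y) : ForSmallProj x fun e => star f * f * e = e := by
  obtain ⟨γ₀, hγ₀, rfl, rfl⟩ := hxy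
  refine ⟨_, IsPartial.image_src_mem_nhds hγ₀ isOpen_univ (mem_univ _),
    fun e he hsupp => ext fun δ => ?_⟩
  rw [he.apply_mul]
  by_cases he0 : e (src δ) = 0
  · rw [he0, mul_zero]
    by_contra hc
    exact hc (by rw [← src_of_mem_units (he.mem_units (Ne.symm hc)), he0])
  obtain ⟨α, ⟨hα, -⟩, hsα⟩ := hsupp _ he0
  have hα := hf.zeroOne.eq_one hα
  rw [he.zeroOne.eq_one he0, mul_one]
  by_cases hδ : δ ∈ units G
  · have h1 : rng (α⁻¹ : G) = rng δ := by
      rw [rng_inv, hsα, src_of_mem_units hδ, mem_units_iff.1 hδ]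
    have h2 : star f α⁻¹ = 1 := by rw [star_apply_eq_one, inv_inv_eq, hα]
    rw [hf.star.mul_apply f h2 h1, inv_inv_eq]
    have h3 : α * δ = α := by rw [← src_of_mem_units hδ, ← hsα, mul_src_self]
    rw [h3, hα]
    rw [src_of_mem_units hδ] at he0
    rw [he.zeroOne.eq_one he0]
  · have h1 : e δ = 0 := by_contra fun h => hδ (he.mem_units h)
    rw [h1]
    by_contra hc
    obtain ⟨ε, η, hε, hη, hs, rfl⟩ := exists_of_mul_apply_ne_zero hc
    have h2 := hf.injRng (hf.zeroOne.eq_one (star_apply_ne_zero.1 hε)) (hf.zeroOne.eq_one hη)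
      (by rw [rng_inv, hs])
    refine hδ ⟨ε, ?_⟩
    rw [← h2, comp_inv]

end ConvAlg

/-! ### The algebraic span of the elements `1 - g` and its module structure over the full group. -/

namespace ConvAlg

variable {G : Type u} [TopologicalSpace G] [ArrowGroupoid G] [AmpleGroupoid G]
  [CompactSpace (units G)]

lemma Moves.mul {u v : ConvAlg G} (hu : IsPartial u) {x y z : G} (hv : Moves v x y)
    (huz : Moves u y z) : Moves (u * v) x z := by
  obtain ⟨γ, hγ, rfl, rfl⟩ := hv
  obtain ⟨δ, hδ, hs, rfl⟩ := huz
  refine ⟨δ * γ, ?_, src_mul hs, rng_mul hs⟩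
  rw [hu.mul_apply v hδ (rng_mul hs).symm, inv_comp_cancel_left hs, hγ]

lemma Moves.star {u : ConvAlg G} {x y : G} (h : Moves u x y) : Moves (star u) y x := by
  obtain ⟨γ, hγ, rfl, rfl⟩ := h
  exact ⟨γ⁻¹, by rw [star_apply_eq_one, inv_inv_eq, hγ], src_inv γ, rng_inv γ⟩

lemma Moves.unique {u : ConvAlg G} (hu : IsPartial u) {x y z : G} (h : Moves u x y)
    (h' : Moves u x z) : y = z := by
  obtain ⟨γ, hγ, rfl, rfl⟩ := h
  obtain ⟨δ, hδ, hs, rfl⟩ := h'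
  rw [hu.injSrc hγ hδ hs.symm]

lemma Moves.mem_units_left {u : ConvAlg G} {x y : G} (h : Moves u x y) : x ∈ units G := by
  obtain ⟨γ, -, rfl, -⟩ := h
  exact src_mem_units γ

lemma moves_one {x : G} (hx : x ∈ units G) : Moves 1 x x :=
  ⟨x, one_apply_of_mem hx, src_of_mem_units hx, mem_units_iff.1 hx⟩

lemma IsFull.exists_moves {u : ConvAlg G} (hu : IsFull u) {x : G} (hx : x ∈ units G) :
    ∃ y, Moves u x y := by
  obtain ⟨γ, h, hs⟩ := hu.exists_src hx
  exact ⟨_, γ, h, hs, rfl⟩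

lemma apply_eq_one_of_mul_eq {u v e : ConvAlg G} (he : IsUnitProj e) {γ : G}
    (hex : e (src γ) = 1) (h : u * e = v * e) (hu : u γ = 1) : v γ = 1 := by
  have := DFunLike.congr_fun h γ
  rwa [he.apply_mul, he.apply_mul, hex, mul_one, mul_one, hu, eq_comm] at this

lemma Moves.congr {u v e : ConvAlg G} (he : IsUnitProj e) {x y : G} (hex : e x = 1)
    (h : u * e = v * e) (hu : Moves u x y) : Moves v x y := by
  obtain ⟨γ, hγ, rfl, rfl⟩ := hu
  exact ⟨γ, apply_eq_one_of_mul_eq he hex h hγ, rfl, rfl⟩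

/-- Bisections which move `x` to a different point are locally off-diagonal. -/
lemma forSmallProj_mul_mul_eq_zero {u : ConvAlg G} (hu : IsPartial u) {x y : G}
    (h : Moves u x y) (hxy : x ≠ y) : ForSmallProj x fun e => e * u * e = 0 :=
  (forSmallProj_mul_star_mul_eq_zero isFull_one.isPartial hu (moves_one h.mem_units_left) h
    hxy).mono fun e _ h => by rwa [star_one, mul_one] at h

/-- The span of `1 - 1_U`, for `U ∈ [[G]]`, in `C_c(G)`. -/
noncomputable def augSpan (G : Type u) [TopologicalSpace G] [ArrowGroupoid G] [AmpleGroupoid G]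
    [CompactSpace (units G)] : Submodule ℂ (ConvAlg G) :=
  Submodule.span ℂ {a | ∃ g, IsFull g ∧ a = 1 - g}

lemma one_sub_mem_augSpan {g : ConvAlg G} (hg : IsFull g) : 1 - g ∈ augSpan G :=
  Submodule.subset_span ⟨g, hg, rfl⟩

lemma sub_mem_augSpan {g h : ConvAlg G} (hg : IsFull g) (hh : IsFull h) : g - h ∈ augSpan G := by
  rw [← sub_sub_sub_cancel_left h g 1]
  exact sub_mem (one_sub_mem_augSpan hh) (one_sub_mem_augSpan hg)

/-- `g (1 - k) = g - g k` is again a difference of elements of the full group. With adjoints, the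
span becomes a bimodule over `[[G]]`, and from this an algebra. -/
lemma mul_mem_augSpan {g a : ConvAlg G} (hg : IsFull g) (ha : a ∈ augSpan G) :
    g * a ∈ augSpan G := by
  induction ha using Submodule.span_induction with
  | mem a h =>
    obtain ⟨k, hk, rfl⟩ := h
    rw [mul_sub, mul_one]
    exact sub_mem_augSpan hg (hg.mul hk)
  | zero => rw [mul_zero]; exact zero_mem _
  | add a b _ _ ha hb => rw [mul_add]; exact add_mem ha hb
  | smul c a _ ha => rw [mul_smul_comm]; exact Submodule.smul_mem _ c ha

lemma star_mem_augSpan {a : ConvAlg G} (ha : a ∈ augSpan G) : star a ∈ augSpan G := by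
  induction ha using Submodule.span_induction with
  | mem a h =>
    obtain ⟨k, hk, rfl⟩ := h
    rw [star_sub, star_one]
    exact one_sub_mem_augSpan hk.star
  | zero => rw [star_zero]; exact zero_mem _
  | add a b _ _ ha hb => rw [star_add]; exact add_mem ha hb
  | smul c a _ ha => rw [star_smul]; exact Submodule.smul_mem _ _ ha

lemma mul_mem_augSpan' {g a : ConvAlg G} (hg : IsFull g) (ha : a ∈ augSpan G) :
    a * g ∈ augSpan G := by
  have := star_mem_augSpan (mul_mem_augSpan hg.star (star_mem_augSpan ha))
  rwa [star_mul, star_star, star_star] at this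

lemma mul_mem_augSpan_of_mem {a b : ConvAlg G} (ha : a ∈ augSpan G) (hb : b ∈ augSpan G) :
    a * b ∈ augSpan G := by
  induction ha using Submodule.span_induction with
  | mem a h =>
    obtain ⟨k, hk, rfl⟩ := h
    rw [sub_mul, one_mul]
    exact sub_mem hb (mul_mem_augSpan hk hb)
  | zero => rw [zero_mul]; exact zero_mem _
  | add a b _ _ ha hb => rw [add_mul]; exact add_mem ha hb
  | smul c a _ ha => rw [smul_mul_assoc]; exact Submodule.smul_mem _ c ha

lemma IsFull.star_mul_self_mul {b : ConvAlg G} (hb : IsFull b) (e : ConvAlg G) :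
    Star.star b * b * e = e := by rw [hb.star_mul_self, one_mul]

/-! ### Three points in one orbit: `(1 - u) e (1 - w)` lies in the span for small `e`. -/

section ThreePoints

variable {b c u : ConvAlg G} {x y t z : G}

/-- As `x`, `y`, `t` are distinct, `e`, `b e b*` and `c e c*` are orthogonal for small `e`. The 3 ×
3 identity then exhibits the element as a difference of two products of swaps, and the swaps are in
the full group. -/
lemma forSmallProj_tensor_mem_augSpan (hb : IsFull b) (hc : IsFull c) (hxy : Moves b x y)
    (hxt : Moves c x t) (h1 : x ≠ y) (h2 : x ≠ t) (h3 : y ≠ t) :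
    ForSmallProj x fun e => (1 - b) * e * (1 - star c) ∈ augSpan G := by
  refine (((forSmallProj_mul_mul_eq_zero hb.isPartial hxy h1).and
    (forSmallProj_mul_mul_eq_zero hc.isPartial hxt h2)).and
    (forSmallProj_mul_star_mul_eq_zero hb.isPartial hc.isPartial hxy hxt h3)).mono ?_
  rintro e he ⟨⟨hbe, hce⟩, hbc⟩
  rw [one_sub_mul_mul_one_sub_star (hb.star_mul_self_mul e) he.mul_self he.star_eq hbe hce hbc]
  have hB := isFull_partialSwap hb.isPartial he (hb.star_mul_self_mul e) hbe
  have hC := isFull_partialSwap hc.isPartial he (hc.star_mul_self_mul e) hce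
  exact sub_mem_augSpan (hB.mul (hC.mul hB)) (hC.mul hB)

/-- An element of the topological full group which acts like `u b⁻¹` near `y = b x` and fixes the
points near `x`. -/
lemma forSmallProj_exists_isFull (hb : IsFull b) (hu : IsFull u) (hxy : Moves b x y)
    (hxz : Moves u x z) (h1 : x ≠ y) (h2 : x ≠ z) (h3 : y ≠ z) :
    ForSmallProj x fun e => ∃ v, IsFull v ∧ v * e = e ∧ v * (b * e) = u * e := by
  refine (((forSmallProj_mul_mul_eq_zero hb.isPartial hxy h1).and
    (forSmallProj_mul_mul_eq_zero hu.isPartial hxz h2)).and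
    (forSmallProj_mul_star_mul_eq_zero hb.isPartial hu.isPartial hxy hxz h3)).mono ?_
  rintro e he ⟨⟨hbe, hue⟩, hbu⟩
  have hf := hu.mul hb.star
  have hq := he.conj hb.isPartial
  have hbe' := mul_star_mul_eq_zero he.star_eq hbe
  have hue' := mul_star_mul_eq_zero he.star_eq hue
  have hq0 : b * e * star b * (u * star b) * (b * e * star b) = 0 := by
    have : b * e * star b * (u * star b) * (b * e * star b) =
        b * (e * star b * u * (star b * b * e)) * star b := by noncomm_ring
    rw [this, hb.star_mul_self_mul, hbu, mul_zero, zero_mul]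
  -- The witness exchanges `b e b*` and `u e u*` by means of `u b*`; it fixes `e`, which is
  -- orthogonal to both.
  refine ⟨partialSwap (u * star b) (b * e * star b), isFull_partialSwap hf.isPartial hq
    (hf.star_mul_self_mul _) hq0, partialSwap_mul_of_orthogonal ?_ ?_, ?_⟩
  · rw [mul_assoc, mul_assoc, ← mul_assoc e, hbe', mul_zero]
  · have : b * e * star b * star (u * star b) * e = b * (e * (star b * b * (star u * e))) := by
      rw [star_mul, star_star]
      noncomm_ring
    rw [this, hb.star_mul_self_mul, ← mul_assoc e, hue', mul_zero]
  · have h4 : b * e = b * e * star b * b := by rw [mul_assoc, hb.star_mul_self, mul_one]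
    have h5 : u * star b * (b * e * star b) * b = u * (star b * b * e) * (star b * b) := by
      noncomm_ring
    have h6 := partialSwap_mul_self_right hq.mul_self hq.star_eq hq0
    generalize partialSwap (u * star b) (b * e * star b) = v at h6 ⊢
    rw [h4, ← mul_assoc, h6, h5, hb.star_mul_self_mul, hb.star_mul_self, mul_one]

/-- The left `[[G]]`-module generated by `a`. -/
noncomputable def leftSpan (a : ConvAlg G) : Submodule ℂ (ConvAlg G) :=
  Submodule.span ℂ {d | ∃ v, IsFull v ∧ d = v * a}

lemma mul_mem_leftSpan {a v d : ConvAlg G} (hv : IsFull v) (hd : d ∈ leftSpan a) :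
    v * d ∈ leftSpan a := by
  induction hd using Submodule.span_induction with
  | mem d h =>
    obtain ⟨k, hk, rfl⟩ := h
    exact Submodule.subset_span ⟨v * k, hv.mul hk, by rw [mul_assoc]⟩
  | zero => rw [mul_zero]; exact zero_mem _
  | add a b _ _ ha hb => rw [mul_add]; exact add_mem ha hb
  | smul c a _ ha => rw [mul_smul_comm]; exact Submodule.smul_mem _ c ha

lemma mem_leftSpan_self (a : ConvAlg G) : a ∈ leftSpan a :=
  Submodule.subset_span ⟨1, isFull_one, by rw [one_mul]⟩

/-- With `v` fixing `e` and carrying `b e` to `u e`, one gets `v (1 - b) e = (1 - u) e`. -/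
lemma forSmallProj_mem_leftSpan_of_ne (hb : IsFull b) (hu : IsFull u) (hxy : Moves b x y)
    (hxz : Moves u x z) (h1 : x ≠ y) (h2 : x ≠ z) (h3 : y ≠ z) :
    ForSmallProj x fun e => (1 - u) * e ∈ leftSpan ((1 - b) * e) := by
  refine (forSmallProj_exists_isFull hb hu hxy hxz h1 h2 h3).mono ?_
  rintro e - ⟨v, hv, hve, hvb⟩
  refine Submodule.subset_span ⟨v, hv, ?_⟩
  rw [sub_mul, sub_mul, mul_sub, one_mul, hve, hvb]

/-- Spreads an identity known for a single projection `e` around `x` to all smaller ones: the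
support of `e` is itself a neighbourhood of `x`. -/
lemma ForSmallProj.of_forall_le {P : ConvAlg G → Prop} {e : ConvAlg G} (he : IsUnitProj e)
    (hex : e x = 1) (h : ∀ e', IsUnitProj e' → e * e' = e' → P e') : ForSmallProj x P := by
  refine ⟨{γ | e γ ≠ 0}, (isOpen_ne_fun e.continuous continuous_const).mem_nhds (by simp [hex]),
    fun e' he' hs => h e' he' (ext fun γ => ?_)⟩
  rw [he.mul_apply]
  by_cases h0 : e' γ = 0
  · rw [h0, mul_zero]
  · rw [mem_units_iff.1 (he'.mem_units h0), he.zeroOne.eq_one (hs γ h0), one_mul]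

lemma forSmallProj_mem_leftSpan_of_moves_ne (hb : IsFull b) (hc : IsFull c) (hu : IsFull u)
    (hxy : Moves b x y) (hxt : Moves c x t) (hxz : Moves u x z) (h1 : x ≠ y) (h2 : x ≠ t)
    (h3 : y ≠ t) (h4 : x ≠ z) : ForSmallProj x fun e => (1 - u) * e ∈ leftSpan ((1 - b) * e) := by
  by_cases h5 : y = z
  · subst h5
    obtain ⟨e₀, he₀, hex, v, hv, hve, hvb⟩ :=
      (forSmallProj_exists_isFull hb hc hxy hxt h1 h2 h3).exists hxy.mem_units_left
    have hvx : Moves (v * b) x t := hxt.congr he₀ hex (by rw [mul_assoc, hvb])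
    have hvy : Moves v y t := by
      have := hxy.star.mul (hv.mul hb).isPartial hvx
      rwa [mul_assoc, hb.mul_star_self, mul_one] at this
    have hvu : Moves (v * u) x t := hxz.mul hv.isPartial hvy
    refine ((forSmallProj_mem_leftSpan_of_ne hb (hv.mul hu) hxy hvu h1 h2 h3).and
      (ForSmallProj.of_forall_le he₀ hex fun e he hle =>
        show v * e = e by rw [← hle, ← mul_assoc, hve])).mono ?_
    rintro e - ⟨hmem, hve'⟩
    have hve'' : star v * e = e := by
      nth_rewrite 1 [← hve']
      rw [← mul_assoc, hv.star_mul_self, one_mul]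
    have : (1 - u) * e = star v * ((1 - v * u) * e) := by
      rw [sub_mul, one_mul, sub_mul, one_mul, mul_sub, hve'', mul_assoc v, ← mul_assoc _ v,
        hv.star_mul_self, one_mul]
    rw [this]
    exact mul_mem_leftSpan hv.star hmem
  · exact forSmallProj_mem_leftSpan_of_ne hb hu hxy hxz h1 h4 h5

lemma forSmallProj_mem_leftSpan (hb : IsFull b) (hc : IsFull c) (hu : IsFull u)
    (hxy : Moves b x y) (hxt : Moves c x t) (h1 : x ≠ y) (h2 : x ≠ t) (h3 : y ≠ t) :
    ForSmallProj x fun e => (1 - u) * e ∈ leftSpan ((1 - b) * e) := by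
  obtain ⟨z, hxz⟩ := hu.exists_moves hxy.mem_units_left
  by_cases h4 : x = z
  · subst h4
    obtain ⟨z', hz'⟩ := hb.star.exists_moves hxy.mem_units_left
    have hne : x ≠ z' := by
      rintro rfl
      have := hz'.star
      rw [star_star] at this
      exact h1 (this.unique hb.isPartial hxy)
    refine (forSmallProj_mem_leftSpan_of_moves_ne hb hc (hb.star.mul hu) hxy hxt
      (hxz.mul hb.star.isPartial hz') h1 h2 h3 hne).mono ?_
    intro e _ hmem
    have : (1 - u) * e = (1 - b) * e + b * ((1 - star b * u) * e) := by
      have h : b * (star b * u) = u := by rw [← mul_assoc, hb.mul_star_self, one_mul]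
      rw [← mul_assoc b, mul_sub b, h, mul_one]
      noncomm_ring
    rw [this]
    exact add_mem (mem_leftSpan_self _) (mul_mem_leftSpan hb hmem)
  · exact forSmallProj_mem_leftSpan_of_moves_ne hb hc hu hxy hxt hxz h1 h2 h3 h4

/-- Membership of one product `a a'*` passes to the two modules generated by `a` and `a'`, because
the span absorbs `[[G]]` on both sides. -/
lemma mul_star_mem_augSpan_of_mem_leftSpan {a a' d d' : ConvAlg G} (h : a * star a' ∈ augSpan G)
    (hd : d ∈ leftSpan a) (hd' : d' ∈ leftSpan a') : d * star d' ∈ augSpan G := by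
  have h1 : a * star d' ∈ augSpan G := by
    induction hd' using Submodule.span_induction with
    | mem d h =>
      obtain ⟨k, hk, rfl⟩ := h
      rw [star_mul, ← mul_assoc]
      exact mul_mem_augSpan' hk.star ‹_›
    | zero => rw [star_zero, mul_zero]; exact zero_mem _
    | add a b _ _ ha hb => rw [star_add, mul_add]; exact add_mem ha hb
    | smul c a _ ha => rw [star_smul, mul_smul_comm]; exact Submodule.smul_mem _ _ ha
  induction hd using Submodule.span_induction with
  | mem d h =>
    obtain ⟨k, hk, rfl⟩ := h
    rw [mul_assoc]
    exact mul_mem_augSpan hk h1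
  | zero => rw [zero_mul]; exact zero_mem _
  | add a b _ _ ha hb => rw [add_mul]; exact add_mem ha hb
  | smul c a _ ha => rw [smul_mul_assoc]; exact Submodule.smul_mem _ _ ha

/-- Since `e` is a projection, the element is `(1 - u) e` times the adjoint of `(1 - w*) e`. The
first factor is generated by `(1 - b) e`; the second, with the roles of `b` and `c` exchanged, by
`(1 - c) e`. The tensor case gives the product of these generators. -/
lemma forSmallProj_one_sub_mul_mul_one_sub {w : ConvAlg G} (hb : IsFull b) (hc : IsFull c)
    (hu : IsFull u) (hw : IsFull w) (hxy : Moves b x y) (hxt : Moves c x t) (h1 : x ≠ y)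
    (h2 : x ≠ t) (h3 : y ≠ t) :
    ForSmallProj x fun e => (1 - u) * e * (1 - w) ∈ augSpan G := by
  refine (((forSmallProj_mem_leftSpan hb hc hu hxy hxt h1 h2 h3).and
    (forSmallProj_mem_leftSpan hc hb hw.star hxt hxy h2 h1 h3.symm)).and
    (forSmallProj_tensor_mem_augSpan hb hc hxy hxt h1 h2 h3)).mono ?_
  rintro e he ⟨⟨h4, h5⟩, h6⟩
  have hcalc : ∀ a d : ConvAlg G, a * e * star (star d * e) = a * e * d := fun a d => by
    rw [star_mul, star_star, he.star_eq, mul_assoc a, ← mul_assoc e, he.mul_self, mul_assoc]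
  have h7 := hcalc (1 - b) (1 - star c)
  rw [star_sub, star_one, star_star] at h7
  have h8 := hcalc (1 - u) (1 - w)
  rw [star_sub, star_one] at h8
  rw [← h8]
  exact mul_star_mem_augSpan_of_mem_leftSpan (by rwa [h7]) h4 h5

end ThreePoints

/-! ### Full-group elements through prescribed arrows. -/

lemma isPartial_ind {U : Set G} (hU : IsOpen U) (hUc : IsCompact U) (hb : IsBisection U) :
    IsPartial (ind U hU hUc) := by
  have hval : ∀ γ, ind U hU hUc γ = U.indicator 1 γ := fun _ => rfl
  have hmem : ∀ γ, ind U hU hUc γ = 1 → γ ∈ U := fun γ h => by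
    by_contra hc
    rw [hval, Set.indicator_of_notMem hc] at h
    exact zero_ne_one h
  refine ⟨fun γ => ?_, fun α β hα hβ h => hb.1 (hmem α hα) (hmem β hβ) h,
    fun α β hα hβ h => hb.2 (hmem α hα) (hmem β hβ) h⟩
  rw [hval]
  by_cases h : γ ∈ U <;> simp [h]

/-- Take a compact open bisection through `γ` and cut it down near the source; as source and range
differ, it is then off-diagonal and its partial swap is an element of the full group containing `γ`.
-/
lemma exists_isFull_of_ne {γ : G} (h : src γ ≠ rng γ) : ∃ u : ConvAlg G, IsFull u ∧ u γ = 1 := by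
  obtain ⟨U, hU, hUc, hb, hγ⟩ := exists_compactOpen_bisection γ
  have hV := isPartial_ind hU hUc hb
  have hVγ : ind U hU hUc γ = 1 := Set.indicator_of_mem hγ _
  have hm : Moves (ind U hU hUc) (src γ) (rng γ) := ⟨γ, hVγ, rfl, rfl⟩
  obtain ⟨e, he, hex, h1, h2⟩ := ((forSmallProj_mul_mul_eq_zero hV hm h).and
    (forSmallProj_star_mul_self_mul hV hm)).exists (src_mem_units γ)
  refine ⟨_, isFull_partialSwap hV he h2 h1, apply_eq_one_of_mul_eq he hex ?_ hVγ⟩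
  rw [partialSwap_mul_self_right he.mul_self he.star_eq h1]

lemma exists_isFull_of_orbit {x : G} (h : 3 ≤ (orbit x).encard) {γ : G} (hs : src γ = x) :
    ∃ u : ConvAlg G, IsFull u ∧ u γ = 1 := by
  by_cases hr : src γ = rng γ
  · obtain ⟨-, ⟨β, hβ, rfl⟩, hne⟩ := Set.exists_ne_of_one_lt_encard
      (lt_of_lt_of_le (by norm_num) h) (rng γ)
    have hβ : src β = x := hβ
    have h1 : src γ = rng β⁻¹ := by rw [rng_inv, hβ, hs]
    obtain ⟨u, hu, huβ⟩ := exists_isFull_of_ne (γ := β) (by rw [hβ, ← hs, hr]; exact hne.symm)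
    obtain ⟨v, hv, hvβ⟩ := exists_isFull_of_ne (γ := γ * β⁻¹)
      (by rw [src_mul h1, rng_mul h1, src_inv]; exact hne)
    refine ⟨v * u, hv.mul hu, ?_⟩
    rw [hv.isPartial.mul_apply u hvβ (rng_mul h1), comp_inv_rev h1, inv_inv_eq,
      comp_assoc (by rw [rng_inv, hβ, hs]) (src_inv γ), inv_comp, hs, ← hβ, mul_src_self, huβ]
  · exact exists_isFull_of_ne hr

lemma forSmallProj_of_orbit {x : G} (h : 3 ≤ (orbit x).encard) {u w : ConvAlg G}
    (hu : IsFull u) (hw : IsFull w) :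
    ForSmallProj x fun e => (1 - u) * e * (1 - w) ∈ augSpan G := by
  obtain ⟨y, ⟨β, hβ, rfl⟩, hy⟩ := Set.exists_ne_of_one_lt_encard
    (lt_of_lt_of_le (by norm_num) h) x
  obtain ⟨t, ht, hty⟩ : ∃ t ∈ orbit x, t ∉ ({x, rng β} : Set G) := by
    by_contra! hc
    have := (h.trans (Set.encard_le_encard hc)).trans (Set.encard_pair hy.symm).le
    norm_num at this
  obtain ⟨δ, hδ, rfl⟩ := ht
  have hβ : src β = x := hβ
  have hδ : src δ = x := hδ
  simp only [mem_insert_iff, mem_singleton_iff, not_or] at hty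
  obtain ⟨b, hb, hb1⟩ := exists_isFull_of_ne (γ := β) (by rw [hβ]; exact hy.symm)
  obtain ⟨c, hc, hc1⟩ := exists_isFull_of_ne (γ := δ) (by rw [hδ]; exact Ne.symm hty.1)
  exact forSmallProj_one_sub_mul_mul_one_sub hb hc hu hw ⟨β, hb1, hβ, rfl⟩ ⟨δ, hc1, hδ, rfl⟩
    hy.symm (Ne.symm hty.1) (Ne.symm hty.2)

end ConvAlg

/-! ### A C*-algebraic criterion for heredity. -/

section Hereditary

variable {A : Type*} [CStarAlgebra A] [PartialOrder A] [StarOrderedRing A]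

/-- By functional calculus it is enough that `t (1 - t)^(2n) ≤ 1/n` on `[0, 1]`. Bernoulli gives `(1
+ n t)(1 - t)^n ≤ (1 + t)^n (1 - t)^n = (1 - t²)^n ≤ 1`. -/
lemma norm_one_sub_pow_mul_mul_le {c : A} (hc : 0 ≤ c) (hc1 : ‖c‖ ≤ 1) {n : ℕ} (hn : 0 < n) :
    ‖(1 - c) ^ n * c * (1 - c) ^ n‖ ≤ 1 / n := by
  have hsa : IsSelfAdjoint c := .of_nonneg hc
  have h := cfc_polynomial (R := ℝ) ((1 - Polynomial.X) ^ n * Polynomial.X * (1 - Polynomial.X) ^ n) c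
  simp only [map_mul, map_pow, map_sub, map_one, Polynomial.aeval_X] at h
  rw [← h]
  refine norm_cfc_le (by positivity) fun t ht => ?_
  have ht0 : 0 ≤ t := spectrum_nonneg_of_nonneg hc ht
  have ht1 : t ≤ 1 := by
    cases subsingleton_or_nontrivial A
    · simp at ht
    · exact (le_abs_self t).trans ((spectrum.norm_le_norm_of_mem ht).trans hc1)
  simp only [Polynomial.eval_mul, Polynomial.eval_pow, Polynomial.eval_sub, Polynomial.eval_one,
    Polynomial.eval_X]
  have h1 : 0 ≤ (1 - t) ^ n := pow_nonneg (by linarith) n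
  have h2 : (1 - t) ^ n ≤ 1 := pow_le_one₀ (by linarith) (by linarith)
  have h3 : 1 + n * t ≤ (1 + t) ^ n := one_add_mul_le_pow (by linarith) n
  have h4 : (1 + t) ^ n * (1 - t) ^ n ≤ 1 := by
    rw [← mul_pow]
    exact pow_le_one₀ (by nlinarith) (by nlinarith)
  rw [Real.norm_of_nonneg (by positivity), le_div_iff₀ (by exact_mod_cast hn)]
  have h5 : (1 + n * t) * (1 - t) ^ n ≤ 1 := (mul_le_mul_of_nonneg_right h3 h1).trans h4
  have h6 : 0 ≤ n * t * (1 - t) ^ n := by positivity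
  nlinarith

/-- A closed *-subalgebra `B` with `B A B ⊆ B` is hereditary. -/
lemma NonUnitalStarSubalgebra.isHereditary_of_mul_mul_mem (B : NonUnitalStarSubalgebra ℂ A)
    (hB : IsClosed (B : Set A)) (h : ∀ b ∈ B, ∀ a, ∀ b' ∈ B, b * a * b' ∈ B) :
    IsHereditaryCStarSubalgebra B := by
  refine ⟨hB, fun a b ha hab hb => ?_⟩
  obtain ⟨s, rfl⟩ := CStarAlgebra.nonneg_iff_eq_star_mul_self.1 ha
  have hb0 : 0 ≤ b := ha.trans hab
  set M : ℝ := ‖b‖ + 1 with hM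
  have hM0 : 0 < M := by positivity
  -- Rescaled to a positive contraction; the summand 1 in `M` keeps it invertible when `b = 0`. The
  -- elements `1 - (1 - c)^n` of `B` then act as approximate units for `a = s* s`.
  set c : A := (M⁻¹ : ℝ) • b with hc
  have hcB : c ∈ B := by
    have : c = ((M⁻¹ : ℝ) : ℂ) • b := by rw [hc, Complex.coe_smul]
    rw [this]
    exact SMulMemClass.smul_mem _ hb
  have hc0 : 0 ≤ c := smul_nonneg (by positivity) hb0
  have hc1 : ‖c‖ ≤ 1 := by
    rw [hc, norm_smul, Real.norm_of_nonneg (by positivity), inv_mul_le_one₀ hM0]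
    linarith
  have hbc : b = M • c := by rw [hc, smul_smul, mul_inv_cancel₀ hM0.ne', one_smul]
  have hone : ‖(1 : A)‖ ≤ 1 := by
    cases subsingleton_or_nontrivial A
    · rw [Subsingleton.elim (1 : A) 0, norm_zero]; exact zero_le_one
    · exact CStarRing.norm_one.le
  have hcle : c ≤ 1 := (CStarAlgebra.norm_le_one_iff_of_nonneg c).1 hc1
  have h1c : ‖1 - c‖ ≤ 1 := (CStarAlgebra.norm_le_one_iff_of_nonneg (1 - c)
    (sub_nonneg.2 hcle)).2 (sub_le_self _ hc0)
  let g : ℕ → A := fun n => (1 - c) ^ n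
  have hgsa : ∀ n, IsSelfAdjoint (g n) := fun n =>
    ((IsSelfAdjoint.one A).sub (.of_nonneg hc0)).pow n
  have hg1 : ∀ n, ‖g n‖ ≤ 1 := fun n => by
    induction n with
    | zero => simpa [g] using hone
    | succ n ih =>
      simp only [g, pow_succ] at ih ⊢
      exact (norm_mul_le _ _).trans (mul_le_one₀ ih (norm_nonneg _) h1c)
  have hfB : ∀ n, 1 - g n ∈ B := fun n => by
    induction n with
    | zero => simp [g, zero_mem]
    | succ n ih =>
      have : 1 - g (n + 1) = (1 - g n) + c - (1 - g n) * c := by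
        simp only [g, pow_succ]
        noncomm_ring
      rw [this]
      exact sub_mem (add_mem ih hcB) (mul_mem ih hcB)
  -- The only use of `a ≤ b`: `‖s g‖² = ‖g a g‖ ≤ ‖g b g‖ = M ‖g c g‖ ≤ M / n`.
  have hsg : ∀ n : ℕ, 0 < n → ‖s * g n‖ ≤ Real.sqrt (M * (1 / n)) := fun n hn => by
    refine Real.le_sqrt_of_sq_le ?_
    rw [sq, ← CStarRing.norm_star_mul_self, star_mul, (hgsa n).star_eq]
    have e1 : g n * star s * (s * g n) = g n * (star s * s) * g n := by noncomm_ring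
    rw [e1]
    refine (CStarAlgebra.norm_le_norm_of_nonneg_of_le ((hgsa n).conjugate_nonneg ha)
      ((hgsa n).conjugate_le_conjugate hab)).trans ?_
    rw [hbc, mul_smul_comm, smul_mul_assoc, norm_smul, Real.norm_of_nonneg hM0.le]
    exact mul_le_mul_of_nonneg_left (norm_one_sub_pow_mul_mul_le hc0 hc1 hn) hM0.le
  have hbound : ∀ n : ℕ, 0 < n → ‖(1 - g n) * (star s * s) * (1 - g n) - star s * s‖ ≤
      3 * ‖s‖ * Real.sqrt (M * (1 / n)) := fun n hn => by
    -- Every term of the error contains `s g` or its adjoint.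
    have e1 : (1 - g n) * (star s * s) * (1 - g n) - star s * s =
        -(star (s * g n) * s + (1 - g n) * star s * (s * g n)) := by
      rw [star_mul, (hgsa n).star_eq]
      noncomm_ring
    rw [e1, norm_neg]
    have h1 : ‖star (s * g n) * s‖ ≤ ‖s * g n‖ * ‖s‖ := by
      refine (norm_mul_le _ _).trans ?_
      rw [norm_star]
    have h2 : ‖(1 - g n) * star s * (s * g n)‖ ≤ 2 * ‖s‖ * ‖s * g n‖ := by
      refine (norm_mul_le _ _).trans (mul_le_mul_of_nonneg_right ((norm_mul_le _ _).trans ?_)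
        (norm_nonneg _))
      rw [norm_star]
      refine mul_le_mul_of_nonneg_right ((norm_sub_le _ _).trans ?_) (norm_nonneg _)
      linarith [hg1 n]
    have h3 := mul_le_mul_of_nonneg_left (hsg n hn) (norm_nonneg s)
    linarith [norm_add_le (star (s * g n) * s) ((1 - g n) * star s * (s * g n))]
  have hlim : Filter.Tendsto (fun n : ℕ => 3 * ‖s‖ * Real.sqrt (M * (1 / n))) Filter.atTop (𝓝 0) := by
    have h1 := (tendsto_one_div_atTop_nhds_zero_nat (𝕜 := ℝ)).const_mul M
    have h2 := ((Real.continuous_sqrt.tendsto _).comp h1).const_mul (3 * ‖s‖)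
    simpa using h2
  refine hB.mem_of_tendsto (tendsto_iff_norm_sub_tendsto_zero.2 (squeeze_zero'
    (Filter.Eventually.of_forall fun _ => norm_nonneg _)
    ((Filter.eventually_gt_atTop 0).mono hbound) hlim))
    (Filter.Eventually.of_forall fun n => h _ (hfB n) _ _ (hfB n))

end Hereditary

/-! ### Locally constant approximation on a profinite space. -/

section Density

/-- Locally constant functions are dense among the continuous functions on a profinite space. -/
lemma LocallyConstant.mem_closure_range_toContinuousMap {X : Type*} [TopologicalSpace X]
    [CompactSpace X] [T2Space X] [TotallyDisconnectedSpace X] (k : C(X, ℂ)) :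
    k ∈ closure (range (LocallyConstant.toContinuousMap : LocallyConstant X ℂ → C(X, ℂ))) := by
  let S : StarSubalgebra ℂ C(X, ℂ) :=
    { (LocallyConstant.toContinuousMapAlgHom ℂ : LocallyConstant X ℂ →ₐ[ℂ] C(X, ℂ)).range with
      star_mem' := by
        rintro _ ⟨f, rfl⟩
        exact ⟨f.map star, rfl⟩ }
  have hS : (S : Set C(X, ℂ)) =
      range (LocallyConstant.toContinuousMap : LocallyConstant X ℂ → C(X, ℂ)) := rfl
  have hsep : S.toSubalgebra.SeparatesPoints := by
    intro x y hxy
    obtain ⟨C, hC, hxC, hCy⟩ := compact_exists_isClopen_in_isOpen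
      (isOpen_compl_singleton (x := y)) (show x ∈ ({y}ᶜ : Set X) from hxy)
    refine ⟨_, ⟨_, ⟨LocallyConstant.charFn ℂ hC, rfl⟩, rfl⟩, ?_⟩
    have hyC : y ∉ C := fun h => hCy h rfl
    change LocallyConstant.charFn ℂ hC x ≠ LocallyConstant.charFn ℂ hC y
    rw [LocallyConstant.coe_charFn, Set.indicator_of_mem hxC, Set.indicator_of_notMem hyC]
    exact one_ne_zero
  have := ContinuousMap.starSubalgebra_topologicalClosure_eq_top_of_separatesPoints S hsep
  rw [← hS, ← StarSubalgebra.topologicalClosure_coe, this]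
  trivial

end Density

/-! ### From small projections to arbitrary functions, inside the full C*-algebra. -/

namespace ConvAlg

variable {G : Type u} [TopologicalSpace G] [ArrowGroupoid G] [AmpleGroupoid G]
  [CompactSpace (units G)]

/-- A property of functions which is additive and holds for functions supported near any given
point holds for all functions. -/
lemma local_induction {P : ConvAlg G → Prop} (h0 : P 0) (hadd : ∀ f g, P f → P g → P (f + g))
    (hloc : ∀ γ : G, ∃ U : Set G, IsClopen U ∧ γ ∈ U ∧
      ∀ f : ConvAlg G, Function.support f ⊆ U → P f) (f : ConvAlg G) : P f := by
  have key : ∃ C : Set G, IsClopen C ∧ tsupport f ⊆ C ∧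
      ∀ h : ConvAlg G, Function.support h ⊆ C → P h := by
    refine IsCompact.induction_on (p := fun s => ∃ C : Set G, IsClopen C ∧ s ⊆ C ∧
      ∀ h : ConvAlg G, Function.support h ⊆ C → P h) f.hasCompactSupport ?_ ?_ ?_ ?_
    · refine ⟨∅, isClopen_empty, subset_rfl, fun h hh => ?_⟩
      have : h = 0 := ext fun x => by
        by_contra hx
        exact hh hx
      rwa [this]
    · rintro s t hst ⟨C, hC, htC, h⟩
      exact ⟨C, hC, hst.trans htC, h⟩
    · rintro s t ⟨C, hC, hsC, h⟩ ⟨D, hD, htD, h'⟩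
      refine ⟨C ∪ D, hC.union hD, union_subset_union hsC htD, fun k hk => ?_⟩
      let k₁ : ConvAlg G := restr k C hC
      let k₂ : ConvAlg G := restr k Cᶜ hC.compl
      have : k = k₁ + k₂ := ext fun x => (congrFun (Set.indicator_self_add_compl C k) x).symm
      rw [this]
      refine hadd _ _ (h _ ?_) (h' _ ?_)
      · exact Set.support_indicator_subset
      · intro x hx
        have hx' : x ∈ Cᶜ ∩ Function.support k := by
          rw [← Set.support_indicator]; exact hx
        exact (hk hx'.2).resolve_left hx'.1
    · intro x _
      obtain ⟨U, hU, hx, h⟩ := hloc x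
      exact ⟨U, mem_nhdsWithin_of_mem_nhds (hU.2.mem_nhds hx), U, hU, subset_rfl, h⟩
  obtain ⟨C, -, hfC, h⟩ := key
  exact h f ((subset_tsupport f).trans hfC)

/-- Functions on the unit space, as functions on the groupoid. -/
noncomputable def ofUnits (k : C(units G, ℂ)) : ConvAlg G where
  toFun := (units G).indicator fun γ => k (rngUnit γ)
  continuous_toFun := by
    refine Continuous.indicator ?_ ?_
    · simp [(show IsClopen (units G) from ⟨isClosed_units, isOpen_units⟩).frontier_eq]
    · exact k.continuous.comp AmpleGroupoid.isLocalHomeomorph_rng.continuous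
  hasCompactSupport' := HasCompactSupport.intro isCompact_units
    fun _ hx => Set.indicator_of_notMem hx _

lemma ofUnits_apply (k : C(units G, ℂ)) (γ : G) :
    ofUnits k γ = (units G).indicator (fun γ => k (rngUnit γ)) γ := rfl

lemma ofUnits_apply_of_mem (k : C(units G, ℂ)) {γ : G} (h : γ ∈ units G) :
    ofUnits k γ = k (rngUnit γ) := by
  rw [ofUnits_apply, Set.indicator_of_mem h]

lemma ofUnits_apply_of_notMem (k : C(units G, ℂ)) {γ : G} (h : γ ∉ units G) :
    ofUnits k γ = 0 := by
  rw [ofUnits_apply, Set.indicator_of_notMem h]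

lemma support_ofUnits (k : C(units G, ℂ)) : Function.support (ofUnits k) ⊆ units G :=
  Set.support_indicator_subset

/-- The inclusion of `C(G⁽⁰⁾)` into `C*(G)`. -/
noncomputable def unitsHom (G : Type u) [TopologicalSpace G] [ArrowGroupoid G] [AmpleGroupoid G]
    [CompactSpace (units G)] : C(units G, ℂ) →⋆ₙₐ[ℂ] FullCStar G where
  toFun k := FullCStar.ofCc (ofUnits k)
  map_smul' c k := by
    refine Eq.trans (congrArg _ (ext fun γ => ?_)) (FullCStar.ofCc_smul c _)
    rw [smul_apply]
    by_cases h : γ ∈ units G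
    · rw [ofUnits_apply_of_mem _ h, ofUnits_apply_of_mem _ h]; rfl
    · rw [ofUnits_apply_of_notMem _ h, ofUnits_apply_of_notMem _ h, mul_zero]
  map_zero' := by
    refine Eq.trans (congrArg _ (ext fun γ => ?_)) (UniformSpace.Completion.coe_zero)
    rw [zero_apply]
    by_cases h : γ ∈ units G
    · rw [ofUnits_apply_of_mem _ h]; rfl
    · rw [ofUnits_apply_of_notMem _ h]
  map_add' k l := by
    refine Eq.trans (congrArg _ (ext fun γ => ?_)) (FullCStar.ofCc_add _ _)
    rw [add_apply]
    by_cases h : γ ∈ units G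
    · simp only [ofUnits_apply_of_mem _ h]; rfl
    · simp only [ofUnits_apply_of_notMem _ h, add_zero]
  map_mul' k l := by
    refine Eq.trans (congrArg _ (ext fun γ => ?_)) (FullCStar.ofCc_mul _ _)
    rw [mul_apply, conv_units_left (support_ofUnits k)]
    by_cases h : γ ∈ units G
    · rw [mem_units_iff.1 h]
      simp only [ofUnits_apply_of_mem _ h]; rfl
    · simp only [ofUnits_apply_of_notMem _ h, mul_zero]
  map_star' k := by
    rw [FullCStar.star_ofCc]
    refine congrArg _ (ext fun γ => ?_)
    rw [star_apply]
    by_cases h : γ ∈ units G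
    · rw [inv_of_mem_units h, ofUnits_apply_of_mem _ h, ofUnits_apply_of_mem _ h]; rfl
    · have h' : γ⁻¹ ∉ units G := fun h' => h (by
        rw [← inv_inv_eq γ, inv_of_mem_units h']; exact h')
      rw [ofUnits_apply_of_notMem _ h, ofUnits_apply_of_notMem _ h', star_zero]

lemma unitsHom_apply (k : C(units G, ℂ)) : unitsHom G k = FullCStar.ofCc (ofUnits k) := rfl

/-- A *-homomorphism between C*-algebras is contractive, so the uniform norm on the unit space
dominates the universal norm and no representation has to be examined. -/
lemma continuous_unitsHom : Continuous (unitsHom G) :=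
  AddMonoidHomClass.continuous_of_bound (unitsHom G) 1 fun k => by
    rw [one_mul]
    exact NonUnitalStarAlgHom.norm_apply_le (unitsHom G) k

lemma isUnitProj_ofUnits_charFn {C : Set (units G)} (hC : IsClopen C) :
    IsUnitProj (ofUnits (LocallyConstant.charFn ℂ hC : C(units G, ℂ))) where
  zeroOne γ := by
    by_cases h : γ ∈ units G
    · rw [ofUnits_apply_of_mem _ h]
      change LocallyConstant.charFn ℂ hC (rngUnit γ) = 0 ∨ LocallyConstant.charFn ℂ hC (rngUnit γ) = 1
      rw [LocallyConstant.coe_charFn]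
      by_cases h : rngUnit γ ∈ C <;> simp [h]
    · exact Or.inl (ofUnits_apply_of_notMem _ h)
  mem_units _ h := support_ofUnits _ h

lemma _root_.LocallyConstant.eq_sum_charFn {X : Type*} [TopologicalSpace X] [CompactSpace X]
    (k : LocallyConstant X ℂ) : (k : C(X, ℂ)) = ∑ c ∈ k.range_finite.toFinset,
      c • (LocallyConstant.charFn ℂ (k.isLocallyConstant.isClopen_fiber c) : C(X, ℂ)) := by
  ext x
  rw [ContinuousMap.sum_apply, Finset.sum_eq_single (k x)]
  · simp [LocallyConstant.coe_charFn]
  · intro c _ hc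
    simp [LocallyConstant.coe_charFn, hc.symm]
  · intro h
    simp at h

/-- Functions supported in a clopen set of units lie in the closed span of the unit projections
below it. -/
lemma map_ofCc_mem_of_forall_isUnitProj {e : ConvAlg G} (he : IsUnitProj e)
    {W : Submodule ℂ (FullCStar G)} (hW : IsClosed (W : Set (FullCStar G)))
    (φ : FullCStar G →L[ℂ] FullCStar G)
    (h : ∀ e', IsUnitProj e' → e * e' = e' → φ (FullCStar.ofCc e') ∈ W) {f : ConvAlg G}
    (hf : ∀ γ, f γ ≠ 0 → e γ ≠ 0) : φ (FullCStar.ofCc f) ∈ W := by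
  -- By continuity `k` may be taken locally constant, hence a combination of characteristic
  -- functions of clopen sets; `e` times such a function is a unit projection below `e`.
  have key : ∀ k : C(units G, ℂ), φ (FullCStar.ofCc e * unitsHom G k) ∈ W := by
    have hcl : IsClosed {k : C(units G, ℂ) | φ (FullCStar.ofCc e * unitsHom G k) ∈ W} :=
      hW.preimage (φ.continuous.comp (continuous_const.mul continuous_unitsHom))
    have := AmpleGroupoid.totallyDisconnected_units (G := G)
    intro k
    refine closure_minimal ?_ hcl (LocallyConstant.mem_closure_range_toContinuousMap k)
    rintro _ ⟨k, rfl⟩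
    rw [mem_ofPred_eq, k.eq_sum_charFn, map_sum, Finset.mul_sum, map_sum]
    refine sum_mem fun c _ => ?_
    rw [map_smul, mul_smul_comm, map_smul, unitsHom_apply, ← FullCStar.ofCc_mul]
    refine W.smul_mem c (h _ (he.mul (isUnitProj_ofUnits_charFn _)) ?_)
    rw [← mul_assoc, he.mul_self]
  let k : C(units G, ℂ) := ⟨fun x => f x.1, f.continuous.comp continuous_subtype_val⟩
  have hk : f = e * ofUnits k := by
    refine ext fun γ => ?_
    rw [he.mul_apply]
    by_cases h0 : γ ∈ units G
    · have hr : (rngUnit γ : G) = γ := mem_units_iff.1 h0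
      rw [ofUnits_apply_of_mem _ h0, mem_units_iff.1 h0]
      change f γ = e γ * f (rngUnit γ : G)
      rw [hr]
      by_cases h1 : f γ = 0
      · rw [h1, mul_zero]
      · rw [he.zeroOne.eq_one (hf γ h1), one_mul]
    · rw [ofUnits_apply_of_notMem _ h0, mul_zero]
      by_contra h1
      exact h0 (he.mem_units (hf γ h1))
  have := key k
  rwa [unitsHom_apply, ← FullCStar.ofCc_mul, ← hk] at this

/-- The canonical map `C_c(G) → C*(G)` as a linear map. -/
noncomputable def ofCcLinear (G : Type u) [TopologicalSpace G] [ArrowGroupoid G] [AmpleGroupoid G]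
    [CompactSpace (units G)] : ConvAlg G →ₗ[ℂ] FullCStar G where
  toFun := FullCStar.ofCc
  map_add' := FullCStar.ofCc_add
  map_smul' := FullCStar.ofCc_smul

lemma ofCc_sub (f g : ConvAlg G) :
    FullCStar.ofCc (f - g) = FullCStar.ofCc f - FullCStar.ofCc g := map_sub (ofCcLinear G) f g

/-- The image in `C*(G)` of the span of `1 - 1_U`, for `U ∈ [[G]]`. -/
noncomputable def augSubalgebra (G : Type u) [TopologicalSpace G] [ArrowGroupoid G]
    [AmpleGroupoid G] [CompactSpace (units G)] : NonUnitalStarSubalgebra ℂ (FullCStar G) :=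
  { (augSpan G).map (ofCcLinear G) with
    mul_mem' := by
      rintro _ _ ⟨a, ha, rfl⟩ ⟨b, hb, rfl⟩
      exact ⟨a * b, mul_mem_augSpan_of_mem ha hb, FullCStar.ofCc_mul a b⟩
    star_mem' := by
      rintro _ ⟨a, ha, rfl⟩
      exact ⟨star a, star_mem_augSpan ha, (FullCStar.star_ofCc a).symm⟩ }

lemma ofCc_mem_augSubalgebra {a : ConvAlg G} (ha : a ∈ augSpan G) :
    FullCStar.ofCc a ∈ augSubalgebra G := ⟨a, ha, rfl⟩

/-- The closed span of `1 - 1_U`, for `U ∈ [[G]]`. -/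
noncomputable def closedAug (G : Type u) [TopologicalSpace G] [ArrowGroupoid G]
    [AmpleGroupoid G] [CompactSpace (units G)] : NonUnitalStarSubalgebra ℂ (FullCStar G) :=
  (augSubalgebra G).topologicalClosure

lemma coe_closedAug : (closedAug G : Set (FullCStar G)) =
    closure ((augSpan G).map (ofCcLinear G) : Set (FullCStar G)) := rfl

lemma ofCc_mem_closedAug {a : ConvAlg G} (ha : a ∈ augSpan G) :
    FullCStar.ofCc a ∈ closedAug G := subset_closure (ofCc_mem_augSubalgebra ha)

lemma isClosed_closedAug : IsClosed (closedAug G : Set (FullCStar G)) := isClosed_closure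

/-! ### The inclusion `B A B ⊆ B`. -/

lemma ofCc_one_sub_mul_mul_one_sub_mem (horb : ∀ x ∈ units G, 3 ≤ (orbit x).encard)
    {u w : ConvAlg G} (hu : IsFull u) (hw : IsFull w) (f : ConvAlg G) :
    FullCStar.ofCc ((1 - u) * f * (1 - w)) ∈ closedAug G := by
  induction f using local_induction with
  | h0 =>
    rw [mul_zero, zero_mul]
    exact ofCc_mem_closedAug (zero_mem _)
  | hadd f g hf hg =>
    rw [mul_add, add_mul, FullCStar.ofCc_add]
    exact add_mem hf hg
  | hloc γ =>
    have hx := horb (src γ) (src_mem_units γ)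
    obtain ⟨g, hg, hgγ⟩ := exists_isFull_of_orbit hx (γ := γ) rfl
    -- Two local statements are needed because later `(1 - u) g = (1 - u g) - (1 - g)`.
    obtain ⟨N, hN, hsmall⟩ := (forSmallProj_of_orbit hx (hu.mul hg) hw).and
      (forSmallProj_of_orbit hx hg hw)
    obtain ⟨e, he, hex, hes⟩ := exists_isUnitProj (src_mem_units γ) hN
    have hzo : ∀ f : ConvAlg G, IsZeroOne f → IsClopen {δ | f δ ≠ 0} := fun f hf => by
      refine ⟨?_, isOpen_ne_fun f.continuous continuous_const⟩
      have : {δ | f δ ≠ 0} = {δ | f δ = 1} := Set.ext fun δ =>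
        ⟨hf.eq_one, fun h => by rw [mem_ofPred_eq, h.out]; exact one_ne_zero⟩
      rw [this]
      exact isClosed_eq f.continuous continuous_const
    refine ⟨{δ | g δ ≠ 0} ∩ src ⁻¹' {δ | e δ ≠ 0}, (hzo g hg.zeroOne).inter
      ((hzo e he.zeroOne).preimage continuous_src), ⟨by simp [hgγ], by simp [hex]⟩, ?_⟩
    intro f hf
    -- As `f` lives on the bisection `g`, over sources in `e`, translating by `g*` gives a function
    -- on the units in `e`.
    set h := star g * f with hh
    have hfg : f = g * h := by rw [hh, ← mul_assoc, hg.mul_star_self, one_mul]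
    have hs : ∀ δ, h δ ≠ 0 → e δ ≠ 0 := fun δ hδ => by
      obtain ⟨α, β, hα, hβ, hαβ, rfl⟩ := exists_of_mul_apply_ne_zero hδ
      obtain ⟨h1, h2⟩ := hf hβ
      have h3 : α⁻¹ = β := hg.isPartial.injRng
        (hg.zeroOne.eq_one (star_apply_ne_zero.1 hα)) (hg.zeroOne.eq_one h1) (by rw [rng_inv, hαβ])
      rw [← inv_inv_eq α, h3, inv_comp]
      exact h2
    let φ : FullCStar G →L[ℂ] FullCStar G :=
      (ContinuousLinearMap.mul ℂ (FullCStar G)).flip (FullCStar.ofCc (1 - w)) ∘L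
        ContinuousLinearMap.mul ℂ (FullCStar G) (FullCStar.ofCc ((1 - u) * g))
    have hφ : ∀ k, φ (FullCStar.ofCc k) = FullCStar.ofCc ((1 - u) * g * k * (1 - w)) := fun k => by
      rw [FullCStar.ofCc_mul, FullCStar.ofCc_mul]; rfl
    have := map_ofCc_mem_of_forall_isUnitProj he (W := (closedAug G).toSubmodule)
      isClosed_closedAug φ (fun e' he' hle => ?_) hs
    · rw [hφ] at this
      rw [hfg, ← mul_assoc]
      exact this
    · rw [hφ]
      obtain ⟨h1, h2⟩ := hsmall e' he' fun δ hδ => hes δ (by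
        have hδ' := he'.mem_units hδ
        rw [← hle, he.mul_apply, mem_units_iff.1 hδ'] at hδ
        exact left_ne_zero_of_mul hδ)
      have : (1 - u) * g * e' * (1 - w) =
          (1 - u * g) * e' * (1 - w) - (1 - g) * e' * (1 - w) := by noncomm_ring
      rw [this]
      exact ofCc_mem_closedAug (sub_mem h1 h2)

lemma ofCc_mul_mul_mem_closedAug (horb : ∀ x ∈ units G, 3 ≤ (orbit x).encard)
    {a b : ConvAlg G} (ha : a ∈ augSpan G) (hb : b ∈ augSpan G) (f : ConvAlg G) :
    FullCStar.ofCc (a * f * b) ∈ closedAug G := by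
  induction ha using Submodule.span_induction with
  | mem a h =>
    obtain ⟨u, hu, rfl⟩ := h
    induction hb using Submodule.span_induction with
    | mem b h =>
      obtain ⟨w, hw, rfl⟩ := h
      exact ofCc_one_sub_mul_mul_one_sub_mem horb hu hw f
    | zero => rw [mul_zero]; exact ofCc_mem_closedAug (zero_mem _)
    | add a b _ _ ha hb => rw [mul_add, FullCStar.ofCc_add]; exact add_mem ha hb
    | smul c a _ ha =>
      rw [mul_smul_comm, FullCStar.ofCc_smul]; exact SMulMemClass.smul_mem c ha
  | zero => rw [zero_mul, zero_mul]; exact ofCc_mem_closedAug (zero_mem _)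
  | add a b _ _ ha hb => rw [add_mul, add_mul, FullCStar.ofCc_add]; exact add_mem ha hb
  | smul c a _ ha =>
    rw [smul_mul_assoc, smul_mul_assoc, FullCStar.ofCc_smul]; exact SMulMemClass.smul_mem c ha

/-- All three factors are approximated, the middle one from `C_c(G)` and the outer ones from the
span; each membership condition is closed. -/
lemma mul_mul_mem_closedAug (horb : ∀ x ∈ units G, 3 ≤ (orbit x).encard) {b b' : FullCStar G}
    (hb : b ∈ closedAug G) (a : FullCStar G) (hb' : b' ∈ closedAug G) :
    b * a * b' ∈ closedAug G := by
  have h1 : ∀ c ∈ augSpan G, ∀ d ∈ augSpan G, ∀ a : FullCStar G,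
      FullCStar.ofCc c * a * FullCStar.ofCc d ∈ closedAug G := fun c hc d hd =>
    FullCStar.induction (isClosed_closedAug.preimage
      ((continuous_const.mul continuous_id).mul continuous_const)) fun f => by
      rw [← FullCStar.ofCc_mul, ← FullCStar.ofCc_mul]
      exact ofCc_mul_mul_mem_closedAug horb hc hd f
  have h2 : ∀ c ∈ augSpan G, FullCStar.ofCc c * a * b' ∈ closedAug G := fun c hc => by
    refine closure_minimal (t := {b' | FullCStar.ofCc c * a * b' ∈ closedAug G}) ?_
      (isClosed_closedAug.preimage (continuous_const.mul continuous_id)) hb'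
    rintro _ ⟨d, hd, rfl⟩
    exact h1 c hc d hd a
  refine closure_minimal (t := {b | b * a * b' ∈ closedAug G}) ?_
    (isClosed_closedAug.preimage ((continuous_id.mul continuous_const).mul continuous_const)) hb
  rintro _ ⟨c, hc, rfl⟩
  exact h2 c hc

/-! ### Compact open full bisections are exactly the unitaries with values 0 and 1. -/

/-- If `α` is the arrow of `f` with source `r(γ)`, then `(f* f)(γ) = f(α γ)`. Injectivity of the
range forces `α γ = α`, so this is nonzero only when `γ` is a unit. -/
lemma star_mul_self_eq_one_of_forall_exists {f : ConvAlg G} (hf : IsPartial f)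
    (h : ∀ x ∈ units G, ∃ α, f α = 1 ∧ src α = x) : star f * f = 1 := by
  refine ext fun γ => ?_
  obtain ⟨α, hα, hs⟩ := h _ (rng_mem_units γ)
  rw [hf.star.mul_apply f (α := α⁻¹) (by rw [star_apply_eq_one, inv_inv_eq, hα])
    (by rw [rng_inv, hs]), inv_inv_eq]
  by_cases hγ : γ ∈ units G
  · rw [one_apply_of_mem hγ]
    have : α * γ = α := by
      nth_rewrite 1 [← mem_units_iff.1 hγ]
      rw [← hs, mul_src_self]
    rw [this, hα]
  · rw [one_apply_of_notMem hγ]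
    by_contra hc
    have h1 : α * γ = α := hf.injRng (hf.zeroOne.eq_one hc) hα (rng_mul hs)
    refine hγ ⟨α⁻¹, ?_⟩
    rw [rng_inv, ← inv_comp_cancel_left hs, h1, inv_comp]

lemma isFull_ind (U : TopFullGroup G) : IsFull (ind U.carrier U.isOpen U.isCompact) := by
  have hp := isPartial_ind U.isOpen U.isCompact U.isBisection
  have hone : ∀ α ∈ U.carrier, ind U.carrier U.isOpen U.isCompact α = 1 :=
    fun α hα => Set.indicator_of_mem hα _
  refine ⟨hp.zeroOne, star_mul_self_eq_one_of_forall_exists hp fun x hx => ?_, ?_⟩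
  · rw [← U.image_src] at hx
    obtain ⟨α, hα, rfl⟩ := hx
    exact ⟨α, hone α hα, rfl⟩
  · have := star_mul_self_eq_one_of_forall_exists hp.star fun x hx => by
      rw [← U.image_rng] at hx
      obtain ⟨α, hα, rfl⟩ := hx
      exact ⟨α⁻¹, by rw [star_apply_eq_one, inv_inv_eq, hone α hα], src_inv α⟩
    rwa [star_star] at this

/-- The bisection is the support of `g`: open because `{g ≠ 0}` is, compact because `{g = 1}` is the
same set and closed. The two unitarity equations make source and range bijective onto the units. -/
lemma IsFull.exists_topFullGroup {g : ConvAlg G} (hg : IsFull g) :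
    ∃ U : TopFullGroup G, ind U.carrier U.isOpen U.isCompact = g := by
  have hne : ∀ γ, g γ = 1 → g γ ≠ 0 := fun γ h => by rw [h]; exact one_ne_zero
  have hset : {γ | g γ ≠ 0} = {γ | g γ = 1} := Set.ext fun γ => ⟨hg.zeroOne.eq_one, hne γ⟩
  refine ⟨⟨{γ | g γ ≠ 0}, isOpen_ne_fun g.continuous continuous_const,
    g.hasCompactSupport.of_isClosed_subset ?_ (subset_tsupport g), ⟨?_, ?_⟩, ?_, ?_⟩, ?_⟩
  · rw [hset]
    exact isClosed_eq g.continuous continuous_const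
  · exact fun α hα β hβ h =>
      hg.isPartial.injRng (hg.zeroOne.eq_one hα) (hg.zeroOne.eq_one hβ) h
  · exact fun α hα β hβ h =>
      hg.isPartial.injSrc (hg.zeroOne.eq_one hα) (hg.zeroOne.eq_one hβ) h
  · refine Subset.antisymm ?_ fun x hx => ?_
    · rintro _ ⟨γ, -, rfl⟩
      exact rng_mem_units γ
    · obtain ⟨α, hα, rfl⟩ := hg.star.exists_src hx
      exact ⟨α⁻¹, hne _ (star_apply_eq_one.1 hα), rng_inv α⟩
  · refine Subset.antisymm ?_ fun x hx => ?_
    · rintro _ ⟨γ, -, rfl⟩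
      exact src_mem_units γ
    · obtain ⟨α, hα, rfl⟩ := hg.exists_src hx
      exact ⟨α, hne _ hα, rfl⟩
  · refine ext fun γ => ?_
    change {γ | g γ ≠ 0}.indicator 1 γ = g γ
    rcases hg.zeroOne γ with h | h
    · rw [Set.indicator_of_notMem (by simp [h]), h]
    · rw [Set.indicator_of_mem (hne γ h), h]; rfl

lemma map_augSpan : (augSpan G).map (ofCcLinear G) =
    Submodule.span ℂ {a | ∃ U : TopFullGroup G, a = 1 - U.toFullCStar} := by
  rw [augSpan, Submodule.map_span]
  congr 1
  ext a
  constructor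
  · rintro ⟨_, ⟨g, hg, rfl⟩, rfl⟩
    obtain ⟨U, rfl⟩ := hg.exists_topFullGroup
    exact ⟨U, ofCc_sub _ _⟩
  · rintro ⟨U, rfl⟩
    exact ⟨_, ⟨_, isFull_ind U, rfl⟩, ofCc_sub _ _⟩

end ConvAlg

theorem theorem4p3 {G : Type*} [TopologicalSpace G] [ArrowGroupoid G] [AmpleGroupoid G]
    [CompactSpace (ArrowGroupoid.units G)]
    (horb : ∀ x ∈ ArrowGroupoid.units G, 3 ≤ (ArrowGroupoid.orbit x).encard) :
    ∃ B : NonUnitalStarSubalgebra ℂ (FullCStar G),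
      (B : Set (FullCStar G)) =
        closure (Submodule.span ℂ {a | ∃ U : TopFullGroup G, a = 1 - U.toFullCStar} :
          Set (FullCStar G)) ∧
      IsHereditaryCStarSubalgebra B := by
  refine ⟨ConvAlg.closedAug G, ?_, ?_⟩
  · rw [ConvAlg.coe_closedAug, ConvAlg.map_augSpan]
  · exact (ConvAlg.closedAug G).isHereditary_of_mul_mul_mem ConvAlg.isClosed_closedAug
      fun b hb a b' hb' => ConvAlg.mul_mul_mem_closedAug horb hb a hb'
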